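/- Setting. Let $n\ge 1$ and let $(K_1,d_{K_1}),\dots,(K_n,d_{K_n})$ be nonempty complete separable metric spaces of diameter at most $1$, with Borel probability measures $\lambda_i$ on $K_i$ and reference points $\ast_i\in K_i$. Let $\|\cdot\|$ be the uniform norm and let $d_n(\mathbf x,\mathbf y)=\frac1n\sum_{i=1}^n d_{K_i}(x_i,y_i)$ on $\prod_i K_i$. For Borel probability measures $\mu,\nu$ on $\prod_iK_i$ let $\overline{d_n}(\mu,\nu)=\inf_\gamma\int d_n(\mathbf x,\mathbf y)\,\gamma(d\mathbf x,d\mathbf y)$, where $\gamma$ runs over all couplings of $\mu$ and $\nu$. For a bounded continuous $g:\prod_iK_i\to\mathbb R$ let $\xi_g$ be the Gibbs measure $\xi_g(d\mathbf x)=e^{g(\mathbf x)}\prod_i\lambda_i(dx_i)\big/\int e^{g}\,d\prod_i\lambda_i$. Fix a bounded continuous $f:\prod_iK_i\to\mathbb R$, let $\mu=\xi_f$, and define the discrete gradient of $f$ by $$\nabla f(\mathbf x,\mathbf y)=\sum_{i=1}^n\big[f(x_1,\dots,x_{i-1},y_i,x_{i+1},\dots,x_n)-f(x_1,\dots,x_{i-1},\ast_i,x_{i+1},\dots,x_n)\big].$$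 Proposition 4.1. Assume that $\mathbf x\mapsto\nabla f(\mathbf x,\cdot)$ is $L$-Lipschitz from $d_n$ to $\|\cdot\|$, where $L\ge 0$. Let $\delta\in\mathbb R$ and let $\mathcal P$ be a finite measurable partition of $\prod_iK_i$ such that $\|\nabla f(\mathbf x,\cdot)-\nabla f(\mathbf y,\cdot)\|<\delta n$ whenever $\mathbf x,\mathbf y$ lie in the same part of $\mathcal P$. For each $P\in\mathcal P$ let $\mathbf y_P\in P$ be a point such that, if $\mu(P)>0$, it minimizes $\overline{d_n}\big(\mu(\,\cdot\mid P),\xi_{\nabla f(\mathbf y,\cdot)}\big)$ over $\mathbf y\in P$, and put $g_P=\nabla f(\mathbf y_P,\cdot)$. Then, for each $P\in\mathcal P$, the function $\mathbf x\mapsto\nabla f(\mathbf x,\cdot)$ is Bochner integrable with respect to $\xi_{g_P}$, and $$\sum_{P\in\mathcal P}\mu(P)\,\Big\|g_P-\int\nabla f(\mathbf x,\cdot)\,\xi_{g_P}(d\mathbf x)\Big\|\le\delta n+L\sqrt{\frac12\Big(\frac{\mathrm H_\mu(\mathcal P)}n+\delta\Big)},$$ where $\mathrm H_\mu(\mathcal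 P)=-\sum_{P\in\mathcal P}\mu(P)\log\mu(P)$ (with $0\log0=0$). -/

import Mathlib

open MeasureTheory ProbabilityTheory
open scoped BoundedContinuousFunction ENNReal NNReal

namespace GibbsMixture

noncomputable section

/-- The normalized Hamming average `d_n(x, y) = (1/n) ∑ i, d_{K_i}(x_i, y_i)`. -/
def avgDist {n : ℕ} {K : Fin n → Type*} [∀ i, MetricSpace (K i)]
    (x y : ∀ i, K i) : ℝ :=
  (1 / (n : ℝ)) * ∑ i, dist (x i) (y i)

/-- The transportation metric over `d_n`: the infimum, over all couplings `γ` of `μ` and `ν`,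
of `∫ d_n(x, y) dγ(x, y)`. The integrand is nonnegative, so the integral and the infimum are
taken in `[0, ∞]`. -/
def transportDist {n : ℕ} {K : Fin n → Type*} [∀ i, MetricSpace (K i)]
    [∀ i, MeasurableSpace (K i)] (μ ν : Measure (∀ i, K i)) : ℝ≥0∞ :=
  ⨅ γ : {γ : Measure ((∀ i, K i) × (∀ i, K i)) // γ.fst = μ ∧ γ.snd = ν},
    ∫⁻ p, ENNReal.ofReal (avgDist p.1 p.2) ∂γ.1

/-- The Gibbs measure with density `exp f / ∫ exp f` relative to the product of the reference
measures `lam i`. -/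
def gibbs {n : ℕ} {K : Fin n → Type*} [∀ i, MetricSpace (K i)]
    [∀ i, MeasurableSpace (K i)] (lam : ∀ i, Measure (K i)) (f : (∀ i, K i) →ᵇ ℝ) :
    Measure (∀ i, K i) :=
  (Measure.pi lam).tilted f

/-- The discrete partial derivative `∂_i f(x, y)`: the value of `f` after the `i`-th coordinate
of `x` is replaced by `y`, minus its value after it is replaced by the reference point `star i`. -/
def partialDiff {n : ℕ} {K : Fin n → Type*} [∀ i, MetricSpace (K i)]
    (f : (∀ i, K i) →ᵇ ℝ) (star : ∀ i, K i) (i : Fin n) (x : ∀ i, K i) (y : K i) : ℝ :=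
  f (Function.update x i y) - f (Function.update x i (star i))

/-- The discrete gradient `∇f(x, ·)` at `x`, that is `y ↦ ∑ i, ∂_i f(x, y_i)`, as a bounded
continuous function; its norm is the uniform norm. -/
def discreteGradient {n : ℕ} {K : Fin n → Type*} [∀ i, MetricSpace (K i)]
    (f : (∀ i, K i) →ᵇ ℝ) (star : ∀ i, K i) (x : ∀ i, K i) : (∀ i, K i) →ᵇ ℝ :=
  BoundedContinuousFunction.ofNormedAddCommGroup
    (fun y => ∑ i, partialDiff f star i x (y i))
    (by
      unfold partialDiff
      refine continuous_finsetSum _ fun i _ => ?_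
      exact (f.continuous.comp (continuous_const.update i (continuous_apply i))).sub
        continuous_const)
    (∑ _i : Fin n, (‖f‖ + ‖f‖))
    (fun y => (norm_sum_le _ _).trans (Finset.sum_le_sum fun i _ =>
      (norm_sub_le _ _).trans (add_le_add (f.norm_coe_le_norm _) (f.norm_coe_le_norm _))))

/-- The Shannon entropy `-∑ μ(P) log μ(P)` of a finite partition. -/
def partitionEntropy {X : Type*} [MeasurableSpace X] (μ : Measure X)
    (parts : Finset (Set X)) : ℝ :=
  ∑ P ∈ parts, Real.negMulLog (μ.real P)

end

end GibbsMixture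

namespace GibbsMixture

/-! ### Averages over one coordinate and subadditivity of entropy -/

section Averaging

/-! Write `μ = ξ_f`, `μ_P = μ(· | P)` and `Z_g = ∫ e^g`. The function `∇f(z, ·)` is a sum of
functions of single coordinates, so its Gibbs measure is a product measure and Marton's
transportation inequality applies to it. In the linear form used throughout, it bounds the distance
from `μ_P` to that product by `s/(2n) · Ent + 1/(4s)` for every `s > 0`
(`transportDist_withDensity_pi_le`), where `Ent` is the relative entropy `∫ f dμ_P - ∫ ∇f(z, ·) dμ_P
+ log Z_{∇f(z,·)} - log Z_f - log μ(P)` (`exists_density_cond_tilted`).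

The minimizer `y_P` does at least as well as every `z ∈ P`, hence as well as the average over `z`
drawn from `μ_P`. Replacing `∇f(z, x)` by `∇f(x, x)` for `x, z ∈ P` costs at most `δ n`. After
weighting by `μ(P)` and summing, the entropies total at most `H_μ(𝒫) + δ n` plus `∫ f dμ - log Z_f -
∫ (∇f(x, x) - log Z_{∇f(x,·)}) μ(dx)`. Since `∇f(x, x) - log Z_{∇f(x,·)} = ∑ i, log (e^f / E_i
e^f)(x)`, with `E_i` the average over coordinate `i`, this last quantity is nonpositive by
subadditivity of entropy (`integral_sub_logPartition_le`).

The mean of `∇f` under `μ_P` is within `δ n` of `g_P`, and within `L` times the transport distance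
of its mean under `ξ_{g_P}`. One `s` serves all parts, so the bounds add up without any appeal to
concavity of the square root; optimizing `s` at the end produces the root. -/

theorem integrable_of_abs_le {α : Type*} [MeasurableSpace α] {μ : Measure α} [IsFiniteMeasure μ]
    {F : α → ℝ} (hF : Measurable F) {M : ℝ} (hM : ∀ x, |F x| ≤ M) : Integrable F μ :=
  Integrable.of_bound hF.aestronglyMeasurable M (ae_of_all _ hM)

/-- Measurable functions with values in a compact subinterval of `(0, ∞)`. -/
def PosBdd {α : Type*} [MeasurableSpace α] (F : α → ℝ) : Prop :=
  Measurable F ∧ ∃ a b : ℝ, 0 < a ∧ ∀ x, a ≤ F x ∧ F x ≤ b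

namespace PosBdd

variable {α : Type*} [MeasurableSpace α] {F G : α → ℝ}

theorem pos (hF : PosBdd F) (x : α) : 0 < F x := by
  obtain ⟨-, a, b, ha, h⟩ := hF
  exact ha.trans_le (h x).1

theorem exists_abs_le (hF : PosBdd F) : ∃ M, ∀ x, |F x| ≤ M := by
  have hp := hF.pos
  obtain ⟨-, a, b, ha, h⟩ := hF
  exact ⟨b, fun x => by rw [abs_of_pos (hp x)]; exact (h x).2⟩

theorem exists_abs_log_le (hF : PosBdd F) : ∃ M, ∀ x, |Real.log (F x)| ≤ M := by
  have hp := hF.pos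
  obtain ⟨-, a, b, ha, h⟩ := hF
  refine ⟨max |Real.log a| |Real.log b|, fun x => ?_⟩
  exact abs_le_max_abs_abs (Real.log_le_log ha (h x).1) (Real.log_le_log (hp x) (h x).2)

theorem integrable (hF : PosBdd F) (μ : Measure α) [IsFiniteMeasure μ] : Integrable F μ := by
  obtain ⟨M, hM⟩ := hF.exists_abs_le
  exact integrable_of_abs_le hF.1 hM

theorem integrable_mul_log (hF : PosBdd F) (hG : PosBdd G) (μ : Measure α) [IsFiniteMeasure μ] :
    Integrable (fun x => F x * Real.log (G x)) μ := by
  obtain ⟨M, hM⟩ := hF.exists_abs_le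
  obtain ⟨N, hN⟩ := hG.exists_abs_log_le
  refine integrable_of_abs_le (M := M * N) (hF.1.mul (Real.measurable_log.comp hG.1)) fun x => ?_
  rw [abs_mul]
  exact mul_le_mul (hM x) (hN x) (abs_nonneg _) ((abs_nonneg _).trans (hM x))

theorem mul (hF : PosBdd F) (hG : PosBdd G) : PosBdd (fun x => F x * G x) := by
  obtain ⟨mF, a, b, ha, h⟩ := hF
  obtain ⟨mG, c, d, hc, k⟩ := hG
  refine ⟨mF.mul mG, a * c, b * d, mul_pos ha hc, fun x => ⟨?_, ?_⟩⟩
  · exact mul_le_mul (h x).1 (k x).1 hc.le (ha.le.trans (h x).1)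
  · exact mul_le_mul (h x).2 (k x).2 (hc.le.trans (k x).1)
      (ha.le.trans ((h x).1.trans (h x).2))

theorem inv (hF : PosBdd F) : PosBdd (fun x => (F x)⁻¹) := by
  have hp := hF.pos
  obtain ⟨mF, a, b, ha, h⟩ := hF
  refine ⟨mF.inv, (max b 1)⁻¹, a⁻¹, by positivity, fun x => ⟨?_, ?_⟩⟩
  · exact inv_anti₀ (hp x) ((h x).2.trans (le_max_left _ _))
  · exact inv_anti₀ ha (h x).1

theorem div (hF : PosBdd F) (hG : PosBdd G) : PosBdd (fun x => F x / G x) := by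
  simpa only [div_eq_mul_inv] using hF.mul hG.inv

theorem const {c : ℝ} (hc : 0 < c) : PosBdd (fun _ : α => c) :=
  ⟨measurable_const, c, c, hc, fun _ => ⟨le_rfl, le_rfl⟩⟩

theorem integral_pos (hF : PosBdd F) (μ : Measure α) [IsProbabilityMeasure μ] :
    0 < ∫ x, F x ∂μ := by
  have hi := hF.integrable μ
  obtain ⟨-, a, b, ha, h⟩ := hF
  calc 0 < a := ha
    _ = ∫ _, a ∂μ := by simp
    _ ≤ _ := integral_mono (integrable_const _) hi fun x => (h x).1

theorem exp_of_abs_le (hF : Measurable F) {M : ℝ} (hM : ∀ x, |F x| ≤ M) :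
    PosBdd (fun x => Real.exp (F x)) :=
  ⟨hF.exp, Real.exp (-M), Real.exp M, Real.exp_pos _, fun x =>
    ⟨Real.exp_le_exp.2 (abs_le.1 (hM x)).1, Real.exp_le_exp.2 (abs_le.1 (hM x)).2⟩⟩

end PosBdd

variable {ι : Type*} [DecidableEq ι] {X : ι → Type*} [∀ i, MeasurableSpace (X i)]
  (ξ : ∀ i, Measure (X i))

/-- The average of `F` over its `i`-th coordinate. -/
noncomputable def coordAvg (i : ι) (F : (∀ i, X i) → ℝ) (x : ∀ i, X i) : ℝ :=
  ∫ t, F (Function.update x i t) ∂ξ i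

theorem coordAvg_update (i : ι) (F : (∀ i, X i) → ℝ) (x : ∀ i, X i) (t : X i) :
    coordAvg ξ i F (Function.update x i t) = coordAvg ξ i F x := by
  simp [coordAvg]

theorem dependsOn_coordAvg {i : ι} {T : Finset ι} {F : (∀ i, X i) → ℝ}
    (hF : DependsOn F (insert i T : Finset ι)) : DependsOn (coordAvg ξ i F) (T : Set ι) := by
  intro x y hxy
  unfold GibbsMixture.coordAvg
  refine integral_congr_ae (ae_of_all _ fun t => hF fun j hj => ?_)
  by_cases hji : j = i
  · subst hji; simp
  · rw [Function.update_of_ne hji, Function.update_of_ne hji]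
    exact hxy j (by simpa [hji] using hj)

variable [∀ i, IsProbabilityMeasure (ξ i)]

variable {ξ}

theorem measurable_coordAvg (i : ι) {F : (∀ i, X i) → ℝ} (hF : Measurable F) :
    Measurable (coordAvg ξ i F) := by
  have : StronglyMeasurable (fun p : (∀ i, X i) × X i => F (Function.update p.1 i p.2)) :=
    (hF.comp measurable_update').stronglyMeasurable
  exact this.integral_prod_right.measurable

theorem integrable_update (i : ι) {F : (∀ i, X i) → ℝ} (hF : Measurable F) {M : ℝ}
    (hM : ∀ x, |F x| ≤ M) (x : ∀ i, X i) :
    Integrable (fun t => F (Function.update x i t)) (ξ i) :=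
  integrable_of_abs_le (hF.comp (measurable_update x)) fun _ => hM _

theorem coordAvg_mem_Icc (i : ι) {F : (∀ i, X i) → ℝ} (hF : Measurable F) {a b : ℝ}
    (h : ∀ x, F x ∈ Set.Icc a b) (x : ∀ i, X i) : coordAvg ξ i F x ∈ Set.Icc a b := by
  have hi := integrable_update (ξ := ξ) i hF
    (fun x => abs_le_max_abs_abs (h x).1 (h x).2) x
  constructor
  · calc a = ∫ _, a ∂ξ i := by simp
      _ ≤ _ := integral_mono (integrable_const _) hi fun t => (h _).1
  · calc coordAvg ξ i F x ≤ ∫ _, b ∂ξ i :=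
          integral_mono hi (integrable_const _) fun t => (h _).2
      _ = b := by simp

theorem PosBdd.coordAvg (i : ι) {F : (∀ i, X i) → ℝ} (hF : PosBdd F) :
    PosBdd (coordAvg ξ i F) := by
  obtain ⟨mF, a, b, ha, h⟩ := hF
  exact ⟨measurable_coordAvg i mF, a, b, ha, coordAvg_mem_Icc i mF h⟩

variable (ξ) [Fintype ι]

/-- Refreshing one coordinate independently preserves a product measure; it suffices to check boxes.
-/
theorem measurePreserving_update (i : ι) :
    MeasurePreserving (fun p : (∀ i, X i) × X i => Function.update p.1 i p.2)
      ((Measure.pi ξ).prod (ξ i)) (Measure.pi ξ) := by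
  refine ⟨measurable_update', (Measure.pi_eq fun s hs => ?_).symm⟩
  rw [Measure.map_apply measurable_update' (.univ_pi hs)]
  have : (fun p : (∀ i, X i) × X i => Function.update p.1 i p.2) ⁻¹' Set.univ.pi s =
      (Set.univ.pi (Function.update s i Set.univ)) ×ˢ s i := by
    ext ⟨x, t⟩
    simp only [Set.mem_preimage, Set.mem_pi, Set.mem_univ, true_imp_iff, Set.mem_prod]
    constructor
    · intro h
      refine ⟨fun j => ?_, by simpa using h i⟩
      by_cases hj : j = i
      · subst hj; simp
      · simpa [hj] using h j
    · rintro ⟨h, h'⟩ j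
      by_cases hj : j = i
      · subst hj; simpa using h'
      · simpa [hj] using h j
  rw [this, Measure.prod_prod, Measure.pi_pi, ← Finset.mul_prod_erase _ _ (Finset.mem_univ i),
    ← Finset.mul_prod_erase _ (fun j => ξ j (s j)) (Finset.mem_univ i), mul_comm]
  simp only [Function.update_self, measure_univ, one_mul]
  congr 1
  refine Finset.prod_congr rfl fun j hj => ?_
  rw [Function.update_of_ne (Finset.ne_of_mem_erase hj)]

variable {ξ}

theorem integral_coordAvg (i : ι) {F : (∀ i, X i) → ℝ} (hF : Measurable F) {M : ℝ}
    (hM : ∀ x, |F x| ≤ M) :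
    ∫ x, coordAvg ξ i F x ∂Measure.pi ξ = ∫ x, F x ∂Measure.pi ξ := by
  have hm : Measurable (fun p : (∀ i, X i) × X i => F (Function.update p.1 i p.2)) :=
    hF.comp measurable_update'
  rw [← (measurePreserving_update ξ i).map_eq,
    integral_map measurable_update'.aemeasurable hF.aestronglyMeasurable,
    integral_prod _ (integrable_of_abs_le hm fun _ => hM _), (measurePreserving_update ξ i).map_eq]
  rfl

/-- Gibbs' inequality in coordinate `i`: given the other coordinates, `F / E_i F` and `G / E_i G`
are both probability densities, and the expected logarithm under the first is largest for the first
itself. -/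
theorem integral_mul_log_div_coordAvg_le (i : ι) {F G : (∀ i, X i) → ℝ} (hF : PosBdd F)
    (hG : PosBdd G) :
    ∫ x, F x * Real.log (G x / coordAvg ξ i G x) ∂Measure.pi ξ ≤
      ∫ x, F x * Real.log (F x / coordAvg ξ i F x) ∂Measure.pi ξ := by
  have hQ := ((hF.coordAvg (ξ := ξ) i).mul hG).div (hG.coordAvg (ξ := ξ) i)
  set Q : (∀ i, X i) → ℝ := fun x => coordAvg ξ i F x * G x / coordAvg ξ i G x
  have hQint : ∫ x, Q x ∂Measure.pi ξ = ∫ x, F x ∂Measure.pi ξ := by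
    obtain ⟨M, hM⟩ := hQ.exists_abs_le
    obtain ⟨N, hN⟩ := hF.exists_abs_le
    rw [← integral_coordAvg i hQ.1 hM, ← integral_coordAvg i hF.1 hN]
    refine integral_congr_ae (ae_of_all _ fun x => ?_)
    -- The factors `E_i F` and `E_i G` do not depend on coordinate `i`, so they come out of the
    -- average, leaving `E_i Q = E_i F`.
    have : coordAvg ξ i Q x = coordAvg ξ i F x / coordAvg ξ i G x * coordAvg ξ i G x := by
      conv_lhs => unfold coordAvg
      conv_rhs => rw [coordAvg.eq_def ξ i G, ← integral_const_mul]
      refine integral_congr_ae (ae_of_all _ fun t => ?_)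
      simp only [Q, coordAvg_update]
      rw [← coordAvg.eq_def ξ i G]
      ring
    rw [this, div_mul_cancel₀ _ ((hG.coordAvg i).pos x).ne']
  have key : ∀ x, F x * Real.log (G x / coordAvg ξ i G x) + (F x - Q x) ≤
      F x * Real.log (F x / coordAvg ξ i F x) := by
    intro x
    have h1 := hF.pos x
    have h2 := hG.pos x
    have h3 := (hF.coordAvg (ξ := ξ) i).pos x
    have h4 := (hG.coordAvg (ξ := ξ) i).pos x
    have h5 := hQ.pos x
    -- The pointwise inequality `log u ≤ u - 1` at `u = Q / F`; the correction `F - Q` integrates to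
    -- zero.
    have h6 := Real.log_le_sub_one_of_pos (div_pos h5 h1)
    have h7 : Real.log (Q x / F x) = Real.log (G x / coordAvg ξ i G x) -
        Real.log (F x / coordAvg ξ i F x) := by
      rw [← Real.log_div (div_pos h2 h4).ne' (div_pos h1 h3).ne']
      congr 1
      simp only [Q]
      field_simp
    rw [h7] at h6
    have h8 := mul_le_mul_of_nonneg_left h6 h1.le
    have h9 : F x * (Q x / F x - 1) = Q x - F x := by field_simp
    linarith
  have i1 := hF.integrable_mul_log (hG.div (hG.coordAvg (ξ := ξ) i)) (Measure.pi ξ)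
  have i2 := hF.integrable_mul_log (hF.div (hF.coordAvg (ξ := ξ) i)) (Measure.pi ξ)
  have i3 := (hF.integrable (Measure.pi ξ)).sub (hQ.integrable (Measure.pi ξ))
  have := integral_mono (i1.add i3) i2 key
  rw [integral_add' i1 i3, integral_sub' (hF.integrable _) (hQ.integrable _), hQint] at this
  linarith

/-- Averaging out the coordinates of `T` one at a time telescopes `log (G / ∫ G)` into terms `log
(G' / E_i G')`, each controlled by Gibbs' inequality. The second function `G` is kept separate from
`F` because the induction averages `G` while `F` stays fixed. -/
theorem integral_mul_log_div_le_sum (T : Finset ι) {F : (∀ i, X i) → ℝ} (hF : PosBdd F)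
    {G : (∀ i, X i) → ℝ} (hG : PosBdd G) (hT : DependsOn G (T : Set ι)) :
    ∫ x, F x * Real.log (G x / ∫ z, G z ∂Measure.pi ξ) ∂Measure.pi ξ ≤
      ∑ i ∈ T, ∫ x, F x * Real.log (F x / coordAvg ξ i F x) ∂Measure.pi ξ := by
  induction T using Finset.induction_on generalizing G with
  | empty =>
    have hc : ∀ x, ∫ z, G z ∂Measure.pi ξ = G x := fun x => by
      rw [integral_congr_ae (ae_of_all _ fun z => DependsOn.empty (by simpa using hT) z x)]
      simp
    have : ∀ x, F x * Real.log (G x / ∫ z, G z ∂Measure.pi ξ) = 0 := fun x => by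
      rw [hc x, div_self (hG.pos x).ne']; simp
    simp [this]
  | insert i T hi ih =>
    rw [Finset.sum_insert hi]
    have hA := hG.coordAvg (ξ := ξ) i
    have h1 := ih hA (dependsOn_coordAvg ξ hT)
    obtain ⟨M, hM⟩ := hG.exists_abs_le
    rw [integral_coordAvg i hG.1 hM] at h1
    have hc := hG.integral_pos (Measure.pi ξ)
    have h2 := integral_mul_log_div_coordAvg_le (ξ := ξ) i hF hG
    have h3 : ∫ x, F x * Real.log (G x / ∫ z, G z ∂Measure.pi ξ) ∂Measure.pi ξ =
        ∫ x, F x * Real.log (G x / coordAvg ξ i G x) ∂Measure.pi ξ +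
        ∫ x, F x * Real.log (coordAvg ξ i G x / ∫ z, G z ∂Measure.pi ξ) ∂Measure.pi ξ := by
      rw [← integral_add (hF.integrable_mul_log (hG.div hA) _)
        (hF.integrable_mul_log (hA.div (.const hc)) _)]
      refine integral_congr_ae (ae_of_all _ fun x => ?_)
      have g1 := hG.pos x
      have g2 := hA.pos x
      simp only
      rw [Real.log_div g1.ne' hc.ne', Real.log_div g1.ne' g2.ne', Real.log_div g2.ne' hc.ne']
      ring
    linarith

/-- Tensorization (subadditivity) of entropy for product measures. -/
theorem integral_mul_log_div_integral_le_sum {F : (∀ i, X i) → ℝ} (hF : PosBdd F) :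
    ∫ x, F x * Real.log (F x / ∫ z, F z ∂Measure.pi ξ) ∂Measure.pi ξ ≤
      ∑ i, ∫ x, F x * Real.log (F x / coordAvg ξ i F x) ∂Measure.pi ξ :=
  integral_mul_log_div_le_sum Finset.univ hF hF fun x y h => by
    rw [funext fun i => h i (by simp)]

end Averaging

/-! ### Pinsker's inequality -/

section Pinsker

open Real InformationTheory

theorem hasDerivAt_sq_div_add_two {x : ℝ} (hx : 0 < x) :
    HasDerivAt (fun y : ℝ => 3 * (y - 1) ^ 2 / (2 * (y + 2)))
      (3 * (x - 1) * (x + 5) / (2 * (x + 2) ^ 2)) x := by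
  have h1 : HasDerivAt (fun y : ℝ => 3 * (y - 1) ^ 2) (3 * (2 * (x - 1))) x := by
    simpa using (((hasDerivAt_id x).sub_const 1).pow 2).const_mul 3
  have h2 : HasDerivAt (fun y : ℝ => 2 * (y + 2)) 2 x := by
    simpa using ((hasDerivAt_id x).add_const 2).const_mul 2
  convert! h1.div h2 (by positivity) using 1
  field_simp
  ring

theorem hasDerivAt_log_sub {x : ℝ} (hx : 0 < x) :
    HasDerivAt (fun y : ℝ => log y - 3 * (y - 1) * (y + 5) / (2 * (y + 2) ^ 2))
      (1 / x - 27 / (x + 2) ^ 3) x := by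
  have h1 : HasDerivAt (fun y : ℝ => 3 * (y - 1) * (y + 5)) (3 * (x + 5) + 3 * (x - 1)) x := by
    convert! (((hasDerivAt_id x).sub_const 1).const_mul 3).mul ((hasDerivAt_id x).add_const 5)
      using 1
    simp
  have h2 : HasDerivAt (fun y : ℝ => 2 * (y + 2) ^ 2) (2 * (2 * (x + 2))) x := by
    simpa using (((hasDerivAt_id x).add_const 2).pow 2).const_mul 2
  convert! (hasDerivAt_log hx.ne').sub (h1.div h2 (by positivity)) using 1
  field_simp
  ring

/-- The derivative is nonnegative because `(x + 2)^3 - 27 x = (x - 1)^2 (x + 8)`. -/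
theorem monotoneOn_log_sub :
    MonotoneOn (fun y : ℝ => log y - 3 * (y - 1) * (y + 5) / (2 * (y + 2) ^ 2)) (Set.Ioi 0) := by
  refine monotoneOn_of_deriv_nonneg (convex_Ioi 0)
    (fun x hx => (hasDerivAt_log_sub hx).continuousAt.continuousWithinAt)
    (fun x hx => (hasDerivAt_log_sub (by simpa using hx)).differentiableAt.differentiableWithinAt)
    fun x hx => ?_
  have hx : 0 < x := by simpa using hx
  rw [(hasDerivAt_log_sub hx).deriv, sub_nonneg, div_le_div_iff₀ (by positivity) hx]
  nlinarith [mul_nonneg (sq_nonneg (x - 1)) (by linarith : 0 ≤ x + 8)]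

/-- The difference of the two sides vanishes at `1`, and its derivative is increasing with a zero at
`1`, so `1` is the minimum. Continuity at `0` covers the endpoint. -/
theorem sq_div_le_klFun {x : ℝ} (hx : 0 ≤ x) : 3 * (x - 1) ^ 2 / (2 * (x + 2)) ≤ klFun x := by
  set ψ : ℝ → ℝ := fun y => klFun y - 3 * (y - 1) ^ 2 / (2 * (y + 2)) with hψ
  have hd : ∀ {y : ℝ}, 0 < y →
      HasDerivAt ψ (log y - 3 * (y - 1) * (y + 5) / (2 * (y + 2) ^ 2)) y := fun hy =>
    (hasDerivAt_klFun hy.ne').sub (hasDerivAt_sq_div_add_two hy)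
  have hcont : ContinuousOn ψ (Set.Ici 0) := by
    refine continuous_klFun.continuousOn.sub (ContinuousOn.div (by fun_prop) (by fun_prop) ?_)
    intro y hy
    have : (0 : ℝ) ≤ y := hy
    positivity
  have h1 : ψ 1 = 0 := by simp [hψ, klFun_one]
  suffices 0 ≤ ψ x by simpa [hψ] using this
  rw [← h1]
  rcases le_total x 1 with h | h
  · refine antitoneOn_of_deriv_nonpos (convex_Icc 0 1) (hcont.mono Set.Icc_subset_Ici_self)
      (fun y hy => ?_) (fun y hy => ?_) ⟨hx, h⟩ ⟨zero_le_one, le_rfl⟩ h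
    · rw [interior_Icc] at hy
      exact (hd hy.1).differentiableAt.differentiableWithinAt
    · rw [interior_Icc] at hy
      rw [(hd hy.1).deriv]
      simpa using monotoneOn_log_sub hy.1 (Set.mem_Ioi.2 one_pos) hy.2.le
  · refine monotoneOn_of_deriv_nonneg (convex_Ici 1)
      (hcont.mono (Set.Ici_subset_Ici.2 zero_le_one))
      (fun y hy => ?_) (fun y hy => ?_) (Set.mem_Ici.2 le_rfl) h h
    · rw [interior_Ici] at hy
      exact (hd (one_pos.trans hy)).differentiableAt.differentiableWithinAt
    · rw [interior_Ici] at hy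
      have hy0 : 0 < y := one_pos.trans hy
      rw [(hd hy0).deriv]
      simpa using monotoneOn_log_sub (Set.mem_Ioi.2 one_pos) hy0 (le_of_lt hy)

/-- Arithmetic-geometric mean: `s` times the lower bound of `sq_div_le_klFun` and `(x + 2) / (6 s)`
have product `(x - 1)^2 / 4`. -/
theorem abs_sub_one_le_klFun {x s : ℝ} (hx : 0 ≤ x) (hs : 0 < s) :
    |x - 1| ≤ s * klFun x + (x + 2) / (6 * s) := by
  have h := mul_le_mul_of_nonneg_left (sq_div_le_klFun hx) hs.le
  refine le_trans ?_ (add_le_add_left h _)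
  have h2 : s * (3 * (x - 1) ^ 2 / (2 * (x + 2))) + (x + 2) / (6 * s) - |x - 1| =
      (3 * s * |x - 1| - (x + 2)) ^ 2 / (6 * s * (x + 2)) := by
    rw [← sq_abs (x - 1)]
    field_simp
    ring
  have h3 : 0 ≤ (3 * s * |x - 1| - (x + 2)) ^ 2 / (6 * s * (x + 2)) := by positivity
  linarith

/-- Pinsker's inequality for the density `k`, linearized by the arithmetic-geometric mean
inequality with parameter `s`. -/
theorem integral_max_one_sub_le {B : Type*} [MeasurableSpace B] {β : Measure B}
    [IsProbabilityMeasure β] {k : B → ℝ} (h0 : ∀ b, 0 ≤ k b) (hk : Integrable k β)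
    (hkl : Integrable (fun b => k b * log (k b)) β) (h1 : ∫ b, k b ∂β = 1) {s : ℝ} (hs : 0 < s) :
    ∫ b, max (1 - k b) 0 ∂β ≤ s / 2 * ∫ b, k b * log (k b) ∂β + 1 / (4 * s) := by
  have hkl' : (fun b => klFun (k b)) = fun b => k b * log (k b) + (1 - k b) := by
    funext b; rw [klFun_apply]; ring
  have i0 : Integrable (fun b => 1 - k b) β := (integrable_const _).sub hk
  have e0 : ∫ b, (1 - k b) ∂β = 0 := by
    rw [integral_sub (integrable_const _) hk, h1]; simp
  have i1 : Integrable (fun b => klFun (k b)) β := hkl' ▸ hkl.add i0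
  have e1 : ∫ b, klFun (k b) ∂β = ∫ b, k b * log (k b) ∂β := by
    rw [hkl', integral_add hkl i0, e0, add_zero]
  have i2 : Integrable (fun b => s / 2 * klFun (k b)) β := i1.const_mul _
  have i3 : Integrable (fun b => k b + 2) β := hk.add (integrable_const _)
  have i4 : Integrable (fun b => s / 2 * klFun (k b) + (k b + 2) / (12 * s)) β :=
    i2.add (i3.div_const _)
  -- Here `max (1 - k) 0 = (|k - 1| + (1 - k)) / 2`. The last summand has integral zero, and `k + 2`
  -- has integral `3`, whence the constant `1 / (4 s)`.
  have key : ∫ b, max (1 - k b) 0 ∂β ≤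
      ∫ b, (s / 2 * klFun (k b) + (k b + 2) / (12 * s) + (1 - k b) / 2) ∂β := by
    refine integral_mono (i0.sup (integrable_zero _ _ _)) (i4.add (i0.div_const _)) fun b => ?_
    have h := abs_sub_one_le_klFun (h0 b) hs
    have h' : (k b + 2) / (6 * s) = 2 * ((k b + 2) / (12 * s)) := by
      field_simp; ring
    have ha := abs_le.1 h
    simp only [max_le_iff]
    constructor <;> linarith [ha.1, ha.2]
  refine key.trans (le_of_eq ?_)
  rw [integral_add i4 (i0.div_const _), integral_add i2 (i3.div_const _), integral_const_mul,
    integral_div, integral_div, e0, e1, integral_add hk (integrable_const _), h1]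
  simp only [integral_const, probReal_univ, one_smul, zero_div, add_zero]
  field_simp
  ring

end Pinsker

/-! ### The maximal coupling of a density with its reference measure -/

section MaximalCoupling

variable {B : Type*} [MeasurableSpace B] (β : Measure B)

/-- The integral of `F` with respect to the maximal coupling of `k • β` and `β`. -/
noncomputable def maximalCouplingIntegral (k : B → ℝ) (F : B → B → ℝ≥0∞) : ℝ≥0∞ :=
  ∫⁻ t, ENNReal.ofReal (min (k t) 1) * F t t ∂β +
    ∫⁻ t, ∫⁻ t', (∫⁻ u, ENNReal.ofReal (1 - k u) ∂β)⁻¹ *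
      (ENNReal.ofReal (k t - 1) * ENNReal.ofReal (1 - k t')) * F t t' ∂β ∂β

variable {β} {k : B → ℝ}

theorem ofReal_min_add_ofReal_sub_one (x : ℝ) :
    ENNReal.ofReal (min x 1) + ENNReal.ofReal (x - 1) = ENNReal.ofReal x := by
  rcases le_total x 1 with h | h
  · rw [min_eq_left h, ENNReal.ofReal_of_nonpos (by linarith : x - 1 ≤ 0), add_zero]
  · rw [min_eq_right h, ← ENNReal.ofReal_add zero_le_one (by linarith)]
    congr 1; ring

theorem ofReal_min_add_ofReal_one_sub {x : ℝ} (hx : 0 ≤ x) :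
    ENNReal.ofReal (min x 1) + ENNReal.ofReal (1 - x) = 1 := by
  rw [← ENNReal.ofReal_one]
  rcases le_total x 1 with h | h
  · rw [min_eq_left h, ← ENNReal.ofReal_add hx (by linarith)]
    congr 1; ring
  · rw [min_eq_right h, ENNReal.ofReal_of_nonpos (by linarith : 1 - x ≤ 0), add_zero]

/-- Excess and deficit of `k` relative to `1` have equal mass: each completes the mass of `min k 1`
to `1`. -/
theorem lintegral_ofReal_sub_one [IsProbabilityMeasure β] (hk : Measurable k) (h0 : ∀ b, 0 ≤ k b)
    (h1 : ∫⁻ b, ENNReal.ofReal (k b) ∂β = 1) :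
    ∫⁻ b, ENNReal.ofReal (k b - 1) ∂β = ∫⁻ b, ENNReal.ofReal (1 - k b) ∂β := by
  have hm : Measurable fun b => ENNReal.ofReal (min (k b) 1) := by fun_prop
  have e1 : ∫⁻ b, ENNReal.ofReal (min (k b) 1) ∂β + ∫⁻ b, ENNReal.ofReal (k b - 1) ∂β = 1 := by
    rw [← lintegral_add_left hm, ← h1]
    exact lintegral_congr fun b => ofReal_min_add_ofReal_sub_one (k b)
  have e2 : ∫⁻ b, ENNReal.ofReal (min (k b) 1) ∂β + ∫⁻ b, ENNReal.ofReal (1 - k b) ∂β = 1 := by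
    rw [← lintegral_add_left hm, lintegral_congr fun b => ofReal_min_add_ofReal_one_sub (h0 b)]
    simp
  have hfin : ∫⁻ b, ENNReal.ofReal (min (k b) 1) ∂β ≠ ∞ :=
    ne_top_of_le_ne_top ENNReal.one_ne_top (e1 ▸ le_self_add)
  exact (ENNReal.add_right_inj hfin).1 (e1.trans e2.symm)

theorem lintegral_ofReal_one_sub_ne_top [IsProbabilityMeasure β] (h0 : ∀ b, 0 ≤ k b) :
    ∫⁻ b, ENNReal.ofReal (1 - k b) ∂β ≠ ∞ := by
  refine ne_top_of_le_ne_top ENNReal.one_ne_top ?_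
  calc _ ≤ ∫⁻ _, 1 ∂β := lintegral_mono fun b => by
        rw [← ENNReal.ofReal_one]
        exact ENNReal.ofReal_le_ofReal (by linarith [h0 b])
    _ = 1 := by simp

/-- Covers the degenerate normalization `T = 0`, where `T⁻¹ * T` is `0` rather than `1`: then `w`
vanishes almost everywhere and both sides are zero. -/
theorem lintegral_mul_eq_of_lintegral_eq {w φ : B → ℝ≥0∞} (hw : Measurable w) {T : ℝ≥0∞}
    (hT : ∫⁻ b, w b ∂β = T) (hfin : T ≠ ∞) :
    T⁻¹ * T * ∫⁻ b, w b * φ b ∂β = ∫⁻ b, w b * φ b ∂β := by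
  by_cases h : T = 0
  · rw [h, lintegral_eq_zero_iff hw] at hT
    have : ∫⁻ b, w b * φ b ∂β = 0 := by
      rw [← lintegral_zero]
      exact lintegral_congr_ae (hT.mono fun b hb => by simp [hb])
    rw [this, mul_zero]
  · rw [ENNReal.inv_mul_cancel h hfin, one_mul]

theorem measurable_lintegral_one_sub {A B : Type*} [MeasurableSpace A] [MeasurableSpace B]
    {β : Measure B} [SFinite β] {k : A → B → ℝ} (hk : Measurable (Function.uncurry k)) :
    Measurable fun x => ∫⁻ u, ENNReal.ofReal (1 - k x u) ∂β :=
  Measurable.lintegral_prod_right (f := fun x u => ENNReal.ofReal (1 - k x u))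
    (measurable_const.sub hk).ennreal_ofReal

variable [IsProbabilityMeasure β] (hk : Measurable k) (h0 : ∀ b, 0 ≤ k b)
  (h1 : ∫⁻ b, ENNReal.ofReal (k b) ∂β = 1)

include hk h0 h1

theorem maximalCouplingIntegral_left {φ : B → ℝ≥0∞} (hφ : Measurable φ) :
    maximalCouplingIntegral β k (fun t _ => φ t) = ∫⁻ t, ENNReal.ofReal (k t) * φ t ∂β := by
  unfold maximalCouplingIntegral
  have hT := lintegral_ofReal_one_sub_ne_top (β := β) h0
  set T := ∫⁻ u, ENNReal.ofReal (1 - k u) ∂β with hTdef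
  have e : ∀ t, ∫⁻ t', T⁻¹ * (ENNReal.ofReal (k t - 1) * ENNReal.ofReal (1 - k t')) * φ t ∂β =
      T⁻¹ * T * (ENNReal.ofReal (k t - 1) * φ t) := fun t => by
    have : ∀ t', T⁻¹ * (ENNReal.ofReal (k t - 1) * ENNReal.ofReal (1 - k t')) * φ t =
        (T⁻¹ * (ENNReal.ofReal (k t - 1) * φ t)) * ENNReal.ofReal (1 - k t') := fun t' => by ring
    simp_rw [this]
    rw [lintegral_const_mul _ (by fun_prop), ← hTdef]
    ring
  simp_rw [e]
  rw [lintegral_const_mul _ (by fun_prop), lintegral_mul_eq_of_lintegral_eq (by fun_prop)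
    (lintegral_ofReal_sub_one hk h0 h1) hT, ← lintegral_add_left (by fun_prop)]
  refine lintegral_congr fun t => ?_
  rw [← add_mul, ofReal_min_add_ofReal_sub_one (k t)]

theorem maximalCouplingIntegral_right {φ : B → ℝ≥0∞} (hφ : Measurable φ) :
    maximalCouplingIntegral β k (fun _ t => φ t) = ∫⁻ t, φ t ∂β := by
  unfold maximalCouplingIntegral
  have hT := lintegral_ofReal_one_sub_ne_top (β := β) h0
  set T := ∫⁻ u, ENNReal.ofReal (1 - k u) ∂β with hTdef
  have e : ∀ t, ∫⁻ t', T⁻¹ * (ENNReal.ofReal (k t - 1) * ENNReal.ofReal (1 - k t')) * φ t' ∂β =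
      (T⁻¹ * ∫⁻ t', ENNReal.ofReal (1 - k t') * φ t' ∂β) * ENNReal.ofReal (k t - 1) :=
    fun t => by
      have : ∀ t', T⁻¹ * (ENNReal.ofReal (k t - 1) * ENNReal.ofReal (1 - k t')) * φ t' =
          (T⁻¹ * ENNReal.ofReal (k t - 1)) * (ENNReal.ofReal (1 - k t') * φ t') :=
        fun t' => by ring
      simp_rw [this]
      rw [lintegral_const_mul _ (by fun_prop)]
      ring
  simp_rw [e]
  rw [lintegral_const_mul _ (by fun_prop), lintegral_ofReal_sub_one hk h0 h1, ← hTdef,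
    mul_right_comm, lintegral_mul_eq_of_lintegral_eq (by fun_prop) hTdef.symm hT,
    ← lintegral_add_left (by fun_prop)]
  refine lintegral_congr fun t => ?_
  rw [← add_mul, ofReal_min_add_ofReal_one_sub (h0 t), one_mul]

theorem maximalCouplingIntegral_const (c : ℝ≥0∞) :
    maximalCouplingIntegral β k (fun _ _ => c) = c := by
  rw [maximalCouplingIntegral_right hk h0 h1 measurable_const]
  simp

/-- The diagonal part costs nothing, and the off-diagonal part has total mass equal to the deficit
of `k`. -/
theorem maximalCouplingIntegral_le {c : B → B → ℝ≥0∞} (hc : ∀ t t', c t t' ≤ 1)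
    (hd : ∀ t, c t t = 0) :
    maximalCouplingIntegral β k c ≤ ∫⁻ u, ENNReal.ofReal (1 - k u) ∂β := by
  unfold maximalCouplingIntegral
  have hT := lintegral_ofReal_one_sub_ne_top (β := β) h0
  set T := ∫⁻ u, ENNReal.ofReal (1 - k u) ∂β with hTdef
  simp only [hd, mul_zero, lintegral_zero, zero_add]
  calc _ ≤ ∫⁻ t, ∫⁻ t', (T⁻¹ * ENNReal.ofReal (k t - 1)) * ENNReal.ofReal (1 - k t') ∂β ∂β :=
        lintegral_mono fun t => lintegral_mono fun t' =>
          (mul_le_mul_right (hc t t') _).trans_eq (by ring)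
    _ = ∫⁻ t, (T⁻¹ * T) * (ENNReal.ofReal (k t - 1) * 1) ∂β := by
        refine lintegral_congr fun t => ?_
        rw [lintegral_const_mul _ (by fun_prop), ← hTdef]
        ring
    _ = T := by
        rw [lintegral_const_mul _ (by fun_prop), lintegral_mul_eq_of_lintegral_eq (by fun_prop)
          (lintegral_ofReal_sub_one hk h0 h1) hT]
        simpa using lintegral_ofReal_sub_one hk h0 h1
    _ ≤ _ := le_rfl

end MaximalCoupling

/-! ### Resampling one coordinate of a coupling -/

section Resample

variable {ι : Type*} [DecidableEq ι] {X : ι → Type*} [∀ i, MeasurableSpace (X i)]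
  (ξ : ∀ i, Measure (X i))

/-- Resample the `i`-th coordinates of a coupling `γ`: given `(x, x')`, they are replaced by the
maximal coupling of `k x • ξ i` and `ξ i`. -/
noncomputable def resample (i : ι) (k : (∀ i, X i) → X i → ℝ)
    (γ : Measure ((∀ i, X i) × (∀ i, X i))) : Measure ((∀ i, X i) × (∀ i, X i)) :=
  ((γ.prod (ξ i)).withDensity fun q => ENNReal.ofReal (min (k q.1.1 q.2) 1)).map
      (fun q => (Function.update q.1.1 i q.2, Function.update q.1.2 i q.2)) +
    ((γ.prod ((ξ i).prod (ξ i))).withDensity fun q =>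
        (∫⁻ u, ENNReal.ofReal (1 - k q.1.1 u) ∂ξ i)⁻¹ *
          (ENNReal.ofReal (k q.1.1 q.2.1 - 1) * ENNReal.ofReal (1 - k q.1.1 q.2.2))).map
      (fun q => (Function.update q.1.1 i q.2.1, Function.update q.1.2 i q.2.2))

variable {ξ} [∀ i, IsProbabilityMeasure (ξ i)]

theorem Measurable.comp_update {α : Type*} [MeasurableSpace α] {i : ι} {u : α → ∀ i, X i}
    {v : α → X i} (hu : Measurable u) (hv : Measurable v) :
    Measurable fun a => Function.update (u a) i (v a) :=
  measurable_update'.comp (hu.prodMk hv)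

/-- Reads `resample` as a mixture over `(x, x')` of maximal couplings, so that its marginals and
costs can be computed fibrewise. -/
theorem lintegral_resample {i : ι} {k : (∀ i, X i) → X i → ℝ}
    (hk : Measurable (Function.uncurry k))
    (γ : Measure ((∀ i, X i) × (∀ i, X i))) [SFinite γ]
    {F : (∀ i, X i) × (∀ i, X i) → ℝ≥0∞} (hF : Measurable F) :
    ∫⁻ p, F p ∂resample ξ i k γ = ∫⁻ p, maximalCouplingIntegral (ξ i) (k p.1)
      (fun t t' => F (Function.update p.1 i t, Function.update p.2 i t')) ∂γ := by
  have hT := measurable_lintegral_one_sub (β := ξ i) hk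
  have m1 : Measurable fun q : ((∀ i, X i) × (∀ i, X i)) × X i =>
      (Function.update q.1.1 i q.2, Function.update q.1.2 i q.2) :=
    (Measurable.comp_update measurable_fst.fst measurable_snd).prodMk
      (Measurable.comp_update measurable_fst.snd measurable_snd)
  have m2 : Measurable fun q : ((∀ i, X i) × (∀ i, X i)) × X i × X i =>
      (Function.update q.1.1 i q.2.1, Function.update q.1.2 i q.2.2) :=
    (Measurable.comp_update measurable_fst.fst measurable_snd.fst).prodMk
      (Measurable.comp_update measurable_fst.snd measurable_snd.snd)
  have d1 : Measurable fun q : ((∀ i, X i) × (∀ i, X i)) × X i =>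
      ENNReal.ofReal (min (k q.1.1 q.2) 1) :=
    ((hk.comp (measurable_fst.fst.prodMk measurable_snd)).min measurable_const).ennreal_ofReal
  have d2 : Measurable fun q : ((∀ i, X i) × (∀ i, X i)) × X i × X i =>
      (∫⁻ u, ENNReal.ofReal (1 - k q.1.1 u) ∂ξ i)⁻¹ *
        (ENNReal.ofReal (k q.1.1 q.2.1 - 1) * ENNReal.ofReal (1 - k q.1.1 q.2.2)) :=
    (hT.comp measurable_fst.fst).inv.mul
      (((hk.comp (measurable_fst.fst.prodMk measurable_snd.fst)).sub
          measurable_const).ennreal_ofReal.mul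
        (measurable_const.sub
          (hk.comp (measurable_fst.fst.prodMk measurable_snd.snd))).ennreal_ofReal)
  have g1 : Measurable fun q : ((∀ i, X i) × (∀ i, X i)) × X i =>
      F (Function.update q.1.1 i q.2, Function.update q.1.2 i q.2) := hF.comp m1
  have g2 : Measurable fun q : ((∀ i, X i) × (∀ i, X i)) × X i × X i =>
      F (Function.update q.1.1 i q.2.1, Function.update q.1.2 i q.2.2) := hF.comp m2
  have f1 := d1.mul g1
  have f2 := d2.mul g2
  rw [resample, lintegral_add_measure, lintegral_map hF m1, lintegral_map hF m2,
    lintegral_withDensity_eq_lintegral_mul _ d1 g1,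
    lintegral_withDensity_eq_lintegral_mul _ d2 g2,
    lintegral_prod _ f1.aemeasurable, lintegral_prod _ f2.aemeasurable,
    ← lintegral_add_left f1.lintegral_prod_right']
  refine lintegral_congr fun p => ?_
  rw [maximalCouplingIntegral]
  congr 1
  exact lintegral_prod _ (f2.comp measurable_prodMk_left).aemeasurable

section

variable {i : ι} {k : (∀ i, X i) → X i → ℝ} (hk : Measurable (Function.uncurry k))
  (h0 : ∀ x t, 0 ≤ k x t) (h1 : ∀ x, ∫⁻ t, ENNReal.ofReal (k x t) ∂ξ i = 1)
  {γ : Measure ((∀ i, X i) × (∀ i, X i))}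

include hk h0 h1

theorem lintegral_resample_of_update_eq [SFinite γ] {F : (∀ i, X i) × (∀ i, X i) → ℝ≥0∞}
    (hF : Measurable F)
    (hup : ∀ x y t t', F (Function.update x i t, Function.update y i t') = F (x, y)) :
    ∫⁻ p, F p ∂resample ξ i k γ = ∫⁻ p, F p ∂γ := by
  rw [lintegral_resample hk γ hF]
  refine lintegral_congr fun p => ?_
  simp_rw [hup]
  exact maximalCouplingIntegral_const (hk.comp measurable_prodMk_left) (h0 _) (h1 _) _

variable [Fintype ι]

omit hk h0 h1 in
theorem lintegral_lintegral_update (i : ι) {F : (∀ i, X i) → ℝ≥0∞} (hF : Measurable F) :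
    ∫⁻ x, ∫⁻ t, F (Function.update x i t) ∂ξ i ∂Measure.pi ξ = ∫⁻ x, F x ∂Measure.pi ξ := by
  rw [← lintegral_prod (fun p : (∀ i, X i) × X i => F (Function.update p.1 i p.2))
    (hF.comp measurable_update').aemeasurable]
  exact (measurePreserving_update ξ i).lintegral_comp hF

/-- The first marginal of the fibre coupling has density `k x`, and `hHk` is the disintegration of
`H` into `h` and `k`; refreshing coordinate `i` of the product measure reassembles `H`. -/
theorem resample_fst [SFinite γ] {h H : (∀ i, X i) → ℝ≥0∞} (hh : Measurable h)
    (hH : Measurable H)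
    (hHk : ∀ x, (fun t => H (Function.update x i t)) =ᵐ[ξ i]
      fun t => h x * ENNReal.ofReal (k x t))
    (hγ : γ.fst = (Measure.pi ξ).withDensity h) :
    (resample ξ i k γ).fst = (Measure.pi ξ).withDensity H := by
  refine Measure.ext_of_lintegral _ fun φ hφ => ?_
  have mk : Measurable fun q : (∀ i, X i) × X i =>
      ENNReal.ofReal (k q.1 q.2) * φ (Function.update q.1 i q.2) :=
    hk.ennreal_ofReal.mul (hφ.comp measurable_update')
  rw [Measure.fst, lintegral_map hφ measurable_fst,
    lintegral_resample hk γ (F := fun p => φ p.1) (hφ.comp measurable_fst)]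
  have e : ∀ p : (∀ i, X i) × (∀ i, X i), maximalCouplingIntegral (ξ i) (k p.1)
      (fun t _ => φ (Function.update p.1 i t)) =
      ∫⁻ t, ENNReal.ofReal (k p.1 t) * φ (Function.update p.1 i t) ∂ξ i := fun p =>
    maximalCouplingIntegral_left (hk.comp measurable_prodMk_left) (h0 _) (h1 _)
      (hφ.comp (measurable_update _))
  simp_rw [e]
  rw [← lintegral_map (μ := γ) (g := Prod.fst) (f := fun x => ∫⁻ t, ENNReal.ofReal (k x t) *
    φ (Function.update x i t) ∂ξ i) mk.lintegral_prod_right' measurable_fst, ← Measure.fst, hγ,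
    lintegral_withDensity_eq_lintegral_mul _ hh mk.lintegral_prod_right',
    lintegral_withDensity_eq_lintegral_mul _ hH hφ, ← lintegral_lintegral_update i (hH.mul hφ)]
  refine lintegral_congr fun x => ?_
  simp only [Pi.mul_apply]
  rw [← lintegral_const_mul (f := fun t => ENNReal.ofReal (k x t) * φ (Function.update x i t)) _
    (mk.comp measurable_prodMk_left)]
  refine lintegral_congr_ae ((hHk x).mono fun t ht => ?_)
  simp only at ht
  simp only [ht]
  ring

/-- Whatever `x` is, the new coordinate of `x'` has law `ξ i`, so the second marginal only has
coordinate `i` refreshed. -/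
theorem resample_snd [SFinite γ] (hγ : γ.snd = Measure.pi ξ) :
    (resample ξ i k γ).snd = Measure.pi ξ := by
  refine Measure.ext_of_lintegral _ fun φ hφ => ?_
  have mk : Measurable fun q : (∀ i, X i) × X i => φ (Function.update q.1 i q.2) :=
    hφ.comp measurable_update'
  rw [Measure.snd, lintegral_map hφ measurable_snd,
    lintegral_resample hk γ (F := fun p => φ p.2) (hφ.comp measurable_snd)]
  have e : ∀ p : (∀ i, X i) × (∀ i, X i), maximalCouplingIntegral (ξ i) (k p.1)
      (fun _ t => φ (Function.update p.2 i t)) =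
      ∫⁻ t, φ (Function.update p.2 i t) ∂ξ i := fun p =>
    maximalCouplingIntegral_right (hk.comp measurable_prodMk_left) (h0 _) (h1 _)
      (hφ.comp (measurable_update _))
  simp_rw [e]
  rw [← lintegral_map (μ := γ) (g := Prod.snd)
    (f := fun x => ∫⁻ t, φ (Function.update x i t) ∂ξ i) mk.lintegral_prod_right' measurable_snd,
    ← Measure.snd, hγ, lintegral_lintegral_update i hφ]

theorem lintegral_resample_coord_le [SFinite γ] {h : (∀ i, X i) → ℝ≥0∞} (hh : Measurable h)
    (hγ : γ.fst = (Measure.pi ξ).withDensity h) {c : X i → X i → ℝ≥0∞}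
    (hcm : Measurable (Function.uncurry c)) (hc : ∀ t t', c t t' ≤ 1) (hd : ∀ t, c t t = 0) :
    ∫⁻ p, c (p.1 i) (p.2 i) ∂resample ξ i k γ ≤
      ∫⁻ x, h x * ∫⁻ t, ENNReal.ofReal (1 - k x t) ∂ξ i ∂Measure.pi ξ := by
  have mF : Measurable fun p : (∀ i, X i) × (∀ i, X i) => c (p.1 i) (p.2 i) :=
    hcm.comp (((measurable_pi_apply i).comp measurable_fst).prodMk
      ((measurable_pi_apply i).comp measurable_snd))
  have hT := measurable_lintegral_one_sub (β := ξ i) hk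
  rw [lintegral_resample hk γ mF]
  calc _ ≤ ∫⁻ p, ∫⁻ t, ENNReal.ofReal (1 - k p.1 t) ∂ξ i ∂γ := lintegral_mono fun p => by
        simp only [Function.update_self]
        exact maximalCouplingIntegral_le (hk.comp measurable_prodMk_left) (h0 _) (h1 _) hc hd
    _ = ∫⁻ x, ∫⁻ t, ENNReal.ofReal (1 - k x t) ∂ξ i ∂γ.fst := by
        rw [Measure.fst, lintegral_map hT measurable_fst]
    _ = _ := by
        rw [hγ, lintegral_withDensity_eq_lintegral_mul _ hh hT]
        rfl

end

end Resample

/-! ### Marton's coupling, one coordinate at a time -/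

section Marton

variable {ι : Type*} [DecidableEq ι] {X : ι → Type*} [∀ i, MeasurableSpace (X i)]
  (ξ : ∀ i, Measure (X i))

theorem exists_abs_mul_log_le (M : ℝ) : ∃ C, ∀ y, 0 ≤ y → y ≤ M → |y * Real.log y| ≤ C := by
  obtain ⟨C, hC⟩ := isCompact_Icc.exists_bound_of_continuousOn
    (Real.continuous_mul_log.continuousOn (s := Set.Icc 0 M))
  exact ⟨C, fun y h0 h1 => hC y ⟨h0, h1⟩⟩

/-- Integrate `H log H ≥ H - 1`, which is nonnegativity of `klFun`. -/
theorem integral_mul_log_nonneg {α : Type*} [MeasurableSpace α] {μ : Measure α}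
    [IsProbabilityMeasure μ] {H : α → ℝ} (hH : Measurable H) (h0 : ∀ x, 0 ≤ H x) {M : ℝ}
    (hM : ∀ x, H x ≤ M) (h1 : ∫ x, H x ∂μ = 1) : 0 ≤ ∫ x, H x * Real.log (H x) ∂μ := by
  obtain ⟨C, hC⟩ := exists_abs_mul_log_le M
  have i2 : Integrable (fun x => H x * Real.log (H x)) μ :=
    integrable_of_abs_le (hH.mul (Real.measurable_log.comp hH)) fun x => hC _ (h0 x) (hM x)
  have i3 : Integrable H μ := integrable_of_abs_le hH fun x => by
    rw [abs_of_nonneg (h0 x)]; exact hM x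
  have := integral_mono (i3.sub (integrable_const 1)) i2 fun x => by
    have := InformationTheory.klFun_nonneg (h0 x)
    rw [InformationTheory.klFun_apply] at this
    simp only [Pi.sub_apply]
    linarith
  rw [integral_sub' i3 (integrable_const 1), h1] at this
  simpa using this

open Classical in
/-- The conditional density of the `i`-th coordinate given the other ones, under the density `H`. -/
noncomputable def condDensity (i : ι) (H : (∀ i, X i) → ℝ) (x : ∀ i, X i) (t : X i) : ℝ :=
  -- The default `1` keeps this a probability density at every `x`, so the resampling is defined
  -- everywhere and not just almost everywhere.
  if coordAvg ξ i H x = 0 then 1 else H (Function.update x i t) / coordAvg ξ i H x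

variable {ξ}

theorem coordAvg_nonneg (i : ι) {H : (∀ i, X i) → ℝ} (h0 : ∀ x, 0 ≤ H x) (x : ∀ i, X i) : 0 ≤ coordAvg ξ i H x :=
  integral_nonneg fun _ => h0 _

theorem condDensity_nonneg (i : ι) {H : (∀ i, X i) → ℝ} (h0 : ∀ x, 0 ≤ H x) (x : ∀ i, X i) (t : X i) :
    0 ≤ condDensity ξ i H x t := by
  unfold condDensity
  split_ifs
  · exact zero_le_one
  · exact div_nonneg (h0 _) (coordAvg_nonneg i h0 x)

variable [∀ i, IsProbabilityMeasure (ξ i)] {H : (∀ i, X i) → ℝ} {M : ℝ} (hH : Measurable H)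
  (h0 : ∀ x, 0 ≤ H x) (hM : ∀ x, H x ≤ M) (i : ι)

theorem measurable_condDensity (hH : Measurable H) :
    Measurable (Function.uncurry (condDensity ξ i H)) := by
  have hA := (measurable_coordAvg (ξ := ξ) i hH).comp
    (measurable_fst : Measurable (Prod.fst : (∀ i, X i) × X i → _))
  exact Measurable.ite (hA (measurableSet_singleton 0)) measurable_const
    ((hH.comp measurable_update').div hA)

theorem integral_condDensity (x : ∀ i, X i) : ∫ t, condDensity ξ i H x t ∂ξ i = 1 := by
  unfold condDensity
  split_ifs with h
  · simp
  · rw [integral_div]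
    exact div_self h

include hH h0 hM

theorem update_ae_eq_zero {x : ∀ i, X i} (hx : coordAvg ξ i H x = 0) :
    ∀ᵐ t ∂ξ i, H (Function.update x i t) = 0 := by
  have hi := integrable_update (ξ := ξ) i hH (M := M)
    (fun x => by rw [abs_of_nonneg (h0 x)]; exact hM x) x
  exact (integral_eq_zero_iff_of_nonneg (fun _ => h0 _) hi).1 hx

theorem update_ae_eq_mul_condDensity (x : ∀ i, X i) :
    (fun t => H (Function.update x i t)) =ᵐ[ξ i]
      fun t => coordAvg ξ i H x * condDensity ξ i H x t := by
  by_cases hx : coordAvg ξ i H x = 0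
  · filter_upwards [update_ae_eq_zero hH h0 hM i hx] with t ht
    rw [ht, hx, zero_mul]
  · refine ae_of_all _ fun t => ?_
    simp only [condDensity, if_neg hx]
    rw [mul_div_cancel₀ _ hx]

theorem integrable_condDensity (x : ∀ i, X i) : Integrable (condDensity ξ i H x) (ξ i) := by
  unfold condDensity
  split_ifs
  · exact integrable_const _
  · exact (integrable_update i hH (M := M)
      (fun x => by rw [abs_of_nonneg (h0 x)]; exact hM x) x).div_const _

theorem lintegral_condDensity (x : ∀ i, X i) :
    ∫⁻ t, ENNReal.ofReal (condDensity ξ i H x t) ∂ξ i = 1 := by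
  rw [← ofReal_integral_eq_lintegral_ofReal (integrable_condDensity hH h0 hM i x)
    (ae_of_all _ fun t => condDensity_nonneg i h0 x t), integral_condDensity i x,
    ENNReal.ofReal_one]

/-- Pinsker for the conditional density, multiplied by the marginal `E_i H`. The conditional entropy
then becomes `E_i (H log H) - E_i H log (E_i H)`, which also makes sense, and vanishes, where `E_i H
= 0`. -/
theorem mul_integral_one_sub_condDensity_le {s : ℝ} (hs : 0 < s) (x : ∀ i, X i) :
    coordAvg ξ i H x * ∫ t, max (1 - condDensity ξ i H x t) 0 ∂ξ i ≤
      s / 2 * (coordAvg ξ i (fun x => H x * Real.log (H x)) x -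
        coordAvg ξ i H x * Real.log (coordAvg ξ i H x)) + coordAvg ξ i H x * (1 / (4 * s)) := by
  by_cases hx : coordAvg ξ i H x = 0
  · have : coordAvg ξ i (fun x => H x * Real.log (H x)) x = 0 := by
      refine integral_eq_zero_of_ae ?_
      filter_upwards [update_ae_eq_zero hH h0 hM i hx] with t ht
      simp [ht]
    simp [hx, this]
  · have hpos := (coordAvg_nonneg (ξ := ξ) i h0 x).lt_of_ne' hx
    obtain ⟨C, hC⟩ := exists_abs_mul_log_le M
    have hlog := integrable_update (ξ := ξ) i (hH.mul (Real.measurable_log.comp hH))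
      (fun x => hC _ (h0 x) (hM x)) x
    have hint := integrable_update (ξ := ξ) i hH (M := M)
      (fun x => by rw [abs_of_nonneg (h0 x)]; exact hM x) x
    have e : ∀ t, condDensity ξ i H x t * Real.log (condDensity ξ i H x t) =
        H (Function.update x i t) * Real.log (H (Function.update x i t)) / coordAvg ξ i H x -
          H (Function.update x i t) *
            (Real.log (coordAvg ξ i H x) / coordAvg ξ i H x) := fun t => by
      simp only [condDensity, if_neg hx]
      by_cases hz : H (Function.update x i t) = 0
      · simp [hz]
      · rw [Real.log_div hz hx]
        ring
    have i1 : Integrable (fun t => H (Function.update x i t) *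
        Real.log (H (Function.update x i t)) / coordAvg ξ i H x) (ξ i) := hlog.div_const _
    have i2 : Integrable (fun t => H (Function.update x i t) *
        (Real.log (coordAvg ξ i H x) / coordAvg ξ i H x)) (ξ i) := hint.mul_const _
    have hkl : Integrable (fun t => condDensity ξ i H x t *
        Real.log (condDensity ξ i H x t)) (ξ i) := by
      simp_rw [e]
      exact i1.sub i2
    have hp := integral_max_one_sub_le (fun t => condDensity_nonneg i h0 x t)
      (integrable_condDensity hH h0 hM i x) hkl (integral_condDensity i x) hs
    have hval : ∫ t, condDensity ξ i H x t * Real.log (condDensity ξ i H x t) ∂ξ i =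
        coordAvg ξ i (fun x => H x * Real.log (H x)) x / coordAvg ξ i H x -
          Real.log (coordAvg ξ i H x) := by
      simp_rw [e]
      rw [integral_sub i1 i2, integral_div, integral_mul_const]
      change _ - coordAvg ξ i H x * _ = _
      rw [mul_div_cancel₀ _ hx]
      rfl
    rw [hval] at hp
    refine (mul_le_mul_of_nonneg_left hp hpos.le).trans (le_of_eq ?_)
    field_simp

variable [Fintype ι]

/-- The chain rule for entropy: the expected cost of resampling coordinate `i` is paid for by the
entropy lost when that coordinate is averaged out. The bound `b` is a real number with its sign
recorded, so that these differences can be added before passing to `ℝ≥0∞`. -/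
theorem lintegral_mul_one_sub_condDensity_le {s : ℝ} (hs : 0 < s)
    (h1 : ∫ x, H x ∂Measure.pi ξ = 1) :
    ∃ b : ℝ, 0 ≤ b ∧ ∫⁻ x, ENNReal.ofReal (coordAvg ξ i H x) *
        ∫⁻ t, ENNReal.ofReal (1 - condDensity ξ i H x t) ∂ξ i ∂Measure.pi ξ ≤ ENNReal.ofReal b ∧
      b = s / 2 * (∫ x, H x * Real.log (H x) ∂Measure.pi ξ -
        ∫ x, coordAvg ξ i H x * Real.log (coordAvg ξ i H x) ∂Measure.pi ξ) + 1 / (4 * s) := by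
  obtain ⟨C, hC⟩ := exists_abs_mul_log_le M
  have hb : ∀ x, |H x| ≤ M := fun x => by rw [abs_of_nonneg (h0 x)]; exact hM x
  have hA := measurable_coordAvg (ξ := ξ) i hH
  have hAM := coordAvg_mem_Icc (ξ := ξ) i hH fun x => ⟨h0 x, hM x⟩
  have mlog : Measurable fun x => H x * Real.log (H x) := hH.mul (Real.measurable_log.comp hH)
  have blog : ∀ x, |H x * Real.log (H x)| ≤ C := fun x => hC _ (h0 x) (hM x)
  have CI := coordAvg_mem_Icc (ξ := ξ) i mlog fun x => abs_le.1 (blog x)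
  set g : (∀ i, X i) → ℝ := fun x =>
    s / 2 * (coordAvg ξ i (fun x => H x * Real.log (H x)) x -
        coordAvg ξ i H x * Real.log (coordAvg ξ i H x)) + coordAvg ξ i H x * (1 / (4 * s)) with hg
  have i1 : Integrable (coordAvg ξ i (fun x => H x * Real.log (H x))) (Measure.pi ξ) :=
    integrable_of_abs_le (measurable_coordAvg i mlog) fun x => abs_le.2 (CI x)
  have i2 : Integrable (fun x => coordAvg ξ i H x * Real.log (coordAvg ξ i H x))
      (Measure.pi ξ) :=
    integrable_of_abs_le (hA.mul (Real.measurable_log.comp hA)) fun x =>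
      hC _ (hAM x).1 (hAM x).2
  have i3 : Integrable (coordAvg ξ i H) (Measure.pi ξ) :=
    integrable_of_abs_le hA fun x => by
      rw [abs_of_nonneg (hAM x).1]; exact (hAM x).2
  have hgi : Integrable g (Measure.pi ξ) := ((i1.sub i2).const_mul _).add (i3.mul_const _)
  have hle := mul_integral_one_sub_condDensity_le (ξ := ξ) hH h0 hM i hs
  have hg0 : ∀ x, 0 ≤ g x := fun x => le_trans
    (mul_nonneg (hAM x).1 (integral_nonneg fun t => le_max_right _ _)) (hle x)
  refine ⟨∫ x, g x ∂Measure.pi ξ, integral_nonneg hg0, ?_, ?_⟩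
  · rw [ofReal_integral_eq_lintegral_ofReal hgi (ae_of_all _ hg0)]
    refine lintegral_mono fun x => le_trans (le_of_eq ?_) (ENNReal.ofReal_le_ofReal (hle x))
    have ic : Integrable (fun t => max (1 - condDensity ξ i H x t) 0) (ξ i) :=
      ((integrable_const _).sub (integrable_condDensity hH h0 hM i x)).sup
        (integrable_zero _ _ _)
    rw [ENNReal.ofReal_mul (hAM x).1, ofReal_integral_eq_lintegral_ofReal ic
      (ae_of_all _ fun t => le_max_right _ _)]
    congr 1
    refine lintegral_congr fun t => ?_
    rw [ENNReal.ofReal_max, ENNReal.ofReal_zero, max_eq_left zero_le]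
  · have e : ∫ x, g x ∂Measure.pi ξ =
        s / 2 * (∫ x, coordAvg ξ i (fun x => H x * Real.log (H x)) x ∂Measure.pi ξ -
          ∫ x, coordAvg ξ i H x * Real.log (coordAvg ξ i H x) ∂Measure.pi ξ) +
          (∫ x, coordAvg ξ i H x ∂Measure.pi ξ) * (1 / (4 * s)) := by
      rw [← integral_sub i1 i2, ← integral_const_mul, ← integral_mul_const]
      exact integral_add ((i1.sub i2).const_mul _) (i3.mul_const _)
    rw [e, integral_coordAvg i mlog blog, integral_coordAvg i hH hb, h1, one_mul]

omit hH h0 hM in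
-- Induction on `T`: couple the average of `H` over coordinate `i`, then resample that coordinate
-- from its conditional law. The costs in the other coordinates are untouched, the entropy
-- differences telescope, and each coordinate adds `1 / (4 s)`.
theorem exists_coupling_of_dependsOn {c : ∀ i, X i → X i → ℝ≥0∞}
    (hcm : ∀ i, Measurable (Function.uncurry (c i))) (hc : ∀ i t t', c i t t' ≤ 1)
    (hd : ∀ i t, c i t t = 0) {s : ℝ} (hs : 0 < s) (T : Finset ι) {H : (∀ i, X i) → ℝ}
    (hH : Measurable H) (h0 : ∀ x, 0 ≤ H x) (hM : ∀ x, H x ≤ M)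
    (h1 : ∫ x, H x ∂Measure.pi ξ = 1) (hT : DependsOn H (T : Set ι)) :
    ∃ γ : Measure ((∀ i, X i) × (∀ i, X i)),
      γ.fst = (Measure.pi ξ).withDensity (fun x => ENNReal.ofReal (H x)) ∧
      γ.snd = Measure.pi ξ ∧
      ∫⁻ p, ∑ j ∈ T, c j (p.1 j) (p.2 j) ∂γ ≤
        ENNReal.ofReal (s / 2 * ∫ x, H x * Real.log (H x) ∂Measure.pi ξ +
          T.card * (1 / (4 * s))) := by
  induction T using Finset.induction_on generalizing H with
  | empty =>
    have hone : ∀ x, H x = 1 := fun x => by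
      rw [← h1, integral_congr_ae (ae_of_all _ fun z => DependsOn.empty (by simpa using hT) z x)]
      simp
    -- With no coordinates left, `H = 1` and the diagonal coupling serves.
    refine ⟨(Measure.pi ξ).map fun x => (x, x), ?_, ?_, by simp⟩
    · simp only [hone, ENNReal.ofReal_one, withDensity_const, one_smul]
      rw [Measure.fst_map_prodMk measurable_id']
      exact Measure.map_id
    · rw [Measure.snd_map_prodMk measurable_id']
      exact Measure.map_id
  | insert i T hi ih =>
    have hb : ∀ x, |H x| ≤ M := fun x => by rw [abs_of_nonneg (h0 x)]; exact hM x
    have hA := measurable_coordAvg (ξ := ξ) i hH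
    have hAM := coordAvg_mem_Icc (ξ := ξ) i hH fun x => ⟨h0 x, hM x⟩
    have hA1 : ∫ x, coordAvg ξ i H x ∂Measure.pi ξ = 1 := by rw [integral_coordAvg i hH hb, h1]
    obtain ⟨γ, hγ1, hγ2, hγ3⟩ := ih hA (fun x => (hAM x).1) (fun x => (hAM x).2) hA1
      (dependsOn_coordAvg ξ hT)
    have hprob : IsProbabilityMeasure γ := ⟨by
      rw [← Measure.snd_univ, hγ2, measure_univ]⟩
    have mk := measurable_condDensity (ξ := ξ) i hH
    have k0 := condDensity_nonneg (ξ := ξ) i h0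
    have k1 := lintegral_condDensity (ξ := ξ) hH h0 hM i
    have mc : ∀ j, Measurable fun p : (∀ i, X i) × (∀ i, X i) => c j (p.1 j) (p.2 j) := fun j =>
      (hcm j).comp (((measurable_pi_apply j).comp measurable_fst).prodMk
        ((measurable_pi_apply j).comp measurable_snd))
    refine ⟨resample ξ i (condDensity ξ i H) γ, ?_, resample_snd mk k0 k1 hγ2, ?_⟩
    · refine resample_fst mk k0 k1 hA.ennreal_ofReal hH.ennreal_ofReal (fun x => ?_) hγ1
      filter_upwards [update_ae_eq_mul_condDensity hH h0 hM i x] with t ht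
      rw [ht, ENNReal.ofReal_mul (hAM x).1]
    · obtain ⟨b, hb0, hb1, hb2⟩ := lintegral_mul_one_sub_condDensity_le hH h0 hM i hs h1
      have hcost := (lintegral_resample_coord_le mk k0 k1 hA.ennreal_ofReal hγ1 (hcm i) (hc i)
        (hd i)).trans hb1
      have hrest := lintegral_resample_of_update_eq mk k0 k1 (γ := γ)
        (F := fun p => ∑ j ∈ T, c j (p.1 j) (p.2 j)) (Finset.measurable_fun_sum _ fun j _ => mc j)
        fun x y t t' => Finset.sum_congr rfl fun j hj => by
          have : j ≠ i := fun h => hi (h ▸ hj)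
          simp only [Function.update_of_ne this]
      simp_rw [Finset.sum_insert hi]
      rw [lintegral_add_left (mc i), hrest]
      -- Splitting `ENNReal.ofReal` of a sum requires both summands to be nonnegative; `positivity`
      -- uses this fact for the second.
      have hent : 0 ≤ ∫ x, coordAvg ξ i H x * Real.log (coordAvg ξ i H x) ∂Measure.pi ξ :=
        integral_mul_log_nonneg hA (fun x => (hAM x).1) (fun x => (hAM x).2) hA1
      refine (add_le_add hcost hγ3).trans ?_
      rw [← ENNReal.ofReal_add hb0 (by positivity)]
      refine ENNReal.ofReal_le_ofReal (le_of_eq ?_)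
      rw [hb2, Finset.card_insert_of_notMem hi]
      push_cast
      ring

end Marton

/-! ### Tilted measures: product structure and relative entropy -/

section Tilted

variable {α : Type*} [MeasurableSpace α]

theorem tilted_pi_eq_pi_tilted {ι : Type*} [Fintype ι] {X : ι → Type*}
    [∀ i, MeasurableSpace (X i)] (lam : ∀ i, Measure (X i)) [∀ i, IsProbabilityMeasure (lam i)]
    (g : ∀ i, X i → ℝ) :
    (Measure.pi lam).tilted (fun x => ∑ i, g i (x i)) =
      Measure.pi (fun i => (lam i).tilted (g i)) := by
  refine (Measure.pi_eq fun s hs => ?_).symm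
  have e : ∀ ν : ∀ i, Measure (X i), (∀ i, IsFiniteMeasure (ν i)) →
      ∫ x, Real.exp (∑ i, g i (x i)) ∂Measure.pi ν = ∏ i, ∫ t, Real.exp (g i t) ∂ν i := by
    intro ν hν
    simp_rw [Real.exp_sum]
    exact integral_fintype_prod_eq_prod (fun i t => Real.exp (g i t))
  rw [tilted_apply_eq_ofReal_integral' _ (.univ_pi hs), integral_div, Measure.restrict_pi_pi,
    e _ inferInstance, e _ inferInstance, ← Finset.prod_div_distrib,
    ENNReal.ofReal_prod_of_nonneg fun i _ => div_nonneg
      (integral_nonneg fun _ => (Real.exp_pos _).le) (integral_nonneg fun _ => (Real.exp_pos _).le)]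
  refine Finset.prod_congr rfl fun i _ => ?_
  rw [tilted_apply_eq_ofReal_integral' _ (hs i), integral_div]

/-- The law `λ.tilted f` conditioned on `P` has a bounded density relative to `λ.tilted g`, with
an explicit relative entropy. -/
theorem exists_density_cond_tilted {lam : Measure α} [IsProbabilityMeasure lam] {f g : α → ℝ}
    (hf : Measurable f) (hg : Measurable g) {A B : ℝ} (hA : ∀ x, |f x| ≤ A) (hB : ∀ x, |g x| ≤ B)
    {P : Set α} (hP : MeasurableSet P) (hPpos : lam.tilted f P ≠ 0) :
    ∃ (H : α → ℝ) (M : ℝ), Measurable H ∧ (∀ x, 0 ≤ H x) ∧ (∀ x, H x ≤ M) ∧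
      ∫ x, H x ∂lam.tilted g = 1 ∧
      (lam.tilted f)[|P] = (lam.tilted g).withDensity (fun x => ENNReal.ofReal (H x)) ∧
      ∫ x, H x * Real.log (H x) ∂lam.tilted g =
        ∫ x, f x ∂(lam.tilted f)[|P] - ∫ x, g x ∂(lam.tilted f)[|P] +
          Real.log (∫ x, Real.exp (g x) ∂lam) - Real.log (∫ x, Real.exp (f x) ∂lam) -
          Real.log ((lam.tilted f).real P) := by
  have pf := PosBdd.exp_of_abs_le hf hA
  have pg := PosBdd.exp_of_abs_le hg hB
  have hμ : IsProbabilityMeasure (lam.tilted f) := isProbabilityMeasure_tilted (pf.integrable lam)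
  have hξ : IsProbabilityMeasure (lam.tilted g) := isProbabilityMeasure_tilted (pg.integrable lam)
  have hμP : IsProbabilityMeasure (lam.tilted f)[|P] := cond_isProbabilityMeasure hPpos
  have hq : 0 < (lam.tilted f).real P := ENNReal.toReal_pos hPpos (measure_ne_top _ _)
  set q := (lam.tilted f).real P with hqdef
  have zf := pf.integral_pos lam
  have zg := pg.integral_pos lam
  set Zf := ∫ x, Real.exp (f x) ∂lam
  set Zg := ∫ x, Real.exp (g x) ∂lam
  -- Change of reference measure: tilting by `f` is tilting by `g` and then by `f - g`, with
  -- normalizing constant `Zf / Zg`.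
  have hfg : lam.tilted f = (lam.tilted g).withDensity
      (fun x => ENNReal.ofReal (Real.exp (f x - g x) * (Zg / Zf))) := by
    have h1 : lam.tilted f = (lam.tilted g).tilted (f - g) := by
      rw [tilted_tilted (pg.integrable lam)]
      congr 1
      simp
    rw [h1, Measure.tilted, integral_exp_tilted]
    congr 1
    funext x
    have : g + (f - g) = f := by simp
    rw [this, Pi.sub_apply]
    congr 1
    change _ / (Zf / Zg) = _
    rw [div_div_eq_mul_div, mul_div_assoc]
  set H : α → ℝ := P.indicator fun x => q⁻¹ * (Real.exp (f x - g x) * (Zg / Zf)) with hH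
  have mH : Measurable H :=
    (((hf.sub hg).exp.mul_const _).const_mul _).indicator hP
  have h0 : ∀ x, 0 ≤ H x := fun x => Set.indicator_nonneg (fun _ _ => by positivity) x
  have hM : ∀ x, H x ≤ q⁻¹ * (Real.exp (A + B) * (Zg / Zf)) := fun x => by
    refine Set.indicator_apply_le' (fun _ => ?_) fun _ => by positivity
    have : f x - g x ≤ A + B := by linarith [(abs_le.1 (hA x)).2, (abs_le.1 (hB x)).1]
    gcongr
  have hdens : (lam.tilted f)[|P] =
      (lam.tilted g).withDensity (fun x => ENNReal.ofReal (H x)) := by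
    have : (fun x => ENNReal.ofReal (H x)) = (ENNReal.ofReal q⁻¹) •
        P.indicator (fun x => ENNReal.ofReal (Real.exp (f x - g x) * (Zg / Zf))) := by
      funext x
      by_cases hx : x ∈ P
      · simp [hH, hx, ENNReal.ofReal_mul (inv_nonneg.2 hq.le)]
      · simp [hH, hx]
    have md : Measurable fun x => ENNReal.ofReal (Real.exp (f x - g x) * (Zg / Zf)) :=
      ((hf.sub hg).exp.mul_const _).ennreal_ofReal
    rw [this, withDensity_smul _ (md.indicator hP), withDensity_indicator hP,
      ← restrict_withDensity hP, ← hfg, ProbabilityTheory.cond, ENNReal.ofReal_inv_of_pos hq,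
      hqdef, ofReal_measureReal]
  have hint : ∀ φ : α → ℝ, ∫ x, φ x ∂(lam.tilted f)[|P] = ∫ x, H x * φ x ∂lam.tilted g := by
    intro φ
    rw [hdens, integral_withDensity_eq_integral_toReal_smul mH.ennreal_ofReal
      (ae_of_all _ fun _ => ENNReal.ofReal_lt_top)]
    simp_rw [ENNReal.toReal_ofReal (h0 _), smul_eq_mul]
  refine ⟨H, _, mH, h0, hM, ?_, hdens, ?_⟩
  · simpa using (hint fun _ => 1).symm
  · rw [← hint]
    have i1 : Integrable f (lam.tilted f)[|P] := integrable_of_abs_le hf hA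
    have i2 : Integrable g (lam.tilted f)[|P] := integrable_of_abs_le hg hB
    have i3 : Integrable (fun x => f x - g x) (lam.tilted f)[|P] := i1.sub i2
    -- The conditioned law lives on `P`, where `H` is positive and its logarithm is explicit; `- log
    -- q` comes from the conditioning.
    have e : ∀ᵐ x ∂(lam.tilted f)[|P], Real.log (H x) =
        f x - g x + (Real.log Zg - Real.log Zf - Real.log q) := by
      filter_upwards [ae_cond_mem hP] with x hx
      simp only [hH, Set.indicator_of_mem hx]
      rw [Real.log_mul (by positivity) (by positivity), Real.log_mul (by positivity)
        (by positivity), Real.log_inv, Real.log_exp, Real.log_div zg.ne' zf.ne']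
      ring
    rw [integral_congr_ae e, integral_add i3 (integrable_const _), integral_sub i1 i2]
    simp
    ring

end Tilted

/-! ### Transport estimates for Gibbs measures -/

section Gibbs

variable {n : ℕ} {K : Fin n → Type*} [∀ i, MetricSpace (K i)]

theorem avgDist_nonneg (x y : ∀ i, K i) : 0 ≤ avgDist x y :=
  mul_nonneg (by positivity) (Finset.sum_nonneg fun _ _ => dist_nonneg)

theorem avgDist_le_one (hdiam : ∀ (i : Fin n) (a b : K i), dist a b ≤ 1) (x y : ∀ i, K i) :
    avgDist x y ≤ 1 := by
  rcases n.eq_zero_or_pos with rfl | hn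
  · simp [avgDist]
  · calc avgDist x y ≤ 1 / (n : ℝ) * ∑ _i : Fin n, 1 :=
          mul_le_mul_of_nonneg_left (Finset.sum_le_sum fun i _ => hdiam i _ _) (by positivity)
      _ = 1 := by
          simp only [Finset.sum_const, Finset.card_univ, Fintype.card_fin, nsmul_eq_mul, mul_one]
          field_simp

theorem continuous_avgDist : Continuous fun p : (∀ i, K i) × (∀ i, K i) => avgDist p.1 p.2 := by
  unfold avgDist
  fun_prop

theorem discreteGradient_apply (f : (∀ i, K i) →ᵇ ℝ) (star x y : ∀ i, K i) :
    discreteGradient f star x y = ∑ i, partialDiff f star i x (y i) := rfl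

theorem norm_discreteGradient_le (f : (∀ i, K i) →ᵇ ℝ) (star x : ∀ i, K i) :
    ‖discreteGradient f star x‖ ≤ ∑ _i : Fin n, (‖f‖ + ‖f‖) :=
  BoundedContinuousFunction.norm_ofNormedAddCommGroup_le _ (by positivity) _

theorem continuous_discreteGradient {f : (∀ i, K i) →ᵇ ℝ} {star : ∀ i, K i} {L : ℝ≥0}
    (hL : ∀ x y : ∀ i, K i, ‖discreteGradient f star x - discreteGradient f star y‖
      ≤ (L : ℝ) * avgDist x y) : Continuous (discreteGradient f star) := by
  rw [continuous_iff_continuousAt]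
  intro y
  rw [ContinuousAt, tendsto_iff_norm_sub_tendsto_zero]
  have h : Filter.Tendsto (fun x => (L : ℝ) * avgDist x y) (nhds y) (nhds 0) := by
    have hc : Continuous fun x : ∀ i, K i => (L : ℝ) * avgDist x y :=
      continuous_const.mul (continuous_avgDist.comp (continuous_id.prodMk continuous_const))
    simpa [avgDist] using hc.tendsto y
  exact squeeze_zero (fun _ => norm_nonneg _) (fun x => hL x y) h

theorem abs_apply_le (g : (∀ i, K i) →ᵇ ℝ) (x : ∀ i, K i) : |g x| ≤ ‖g‖ := g.norm_coe_le_norm x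

variable [∀ i, MeasurableSpace (K i)] (lam : ∀ i, Measure (K i))
  [∀ i, IsProbabilityMeasure (lam i)]

theorem gibbs_discreteGradient (f : (∀ i, K i) →ᵇ ℝ) (star x : ∀ i, K i) :
    gibbs lam (discreteGradient f star x) =
      Measure.pi (fun i => (lam i).tilted (partialDiff f star i x)) :=
  tilted_pi_eq_pi_tilted lam fun i => partialDiff f star i x

/-- The logarithm of the normalizing constant of the Gibbs measure with potential `g`. -/
noncomputable def logPartition (g : (∀ i, K i) →ᵇ ℝ) : ℝ :=
  Real.log (∫ x, Real.exp (g x) ∂Measure.pi lam)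

variable [∀ i, BorelSpace (K i)]
  [∀ i, SecondCountableTopology (K i)]

/-- The target space need not be separable; strong measurability comes from continuity on a second
countable domain. -/
theorem integrable_discreteGradient {f : (∀ i, K i) →ᵇ ℝ} {star : ∀ i, K i}
    (hc : Continuous (discreteGradient f star)) (μ : Measure (∀ i, K i)) [IsFiniteMeasure μ] :
    Integrable (discreteGradient f star) μ :=
  Integrable.of_bound hc.stronglyMeasurable.aestronglyMeasurable _
    (ae_of_all _ fun x => norm_discreteGradient_le f star x)

/-- The easy half of Kantorovich duality, for a vector-valued Lipschitz map: integrate the Lipschitz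
bound against an arbitrary coupling, then take the infimum. -/
theorem norm_integral_sub_integral_le (hdiam : ∀ (i : Fin n) (a b : K i), dist a b ≤ 1)
    {f : (∀ i, K i) →ᵇ ℝ} {star : ∀ i, K i} {L : ℝ≥0}
    (hL : ∀ x y : ∀ i, K i, ‖discreteGradient f star x - discreteGradient f star y‖
      ≤ (L : ℝ) * avgDist x y) (μ ν : Measure (∀ i, K i)) [IsProbabilityMeasure μ]
    [IsProbabilityMeasure ν] (hfin : transportDist μ ν ≠ ∞) :
    ‖∫ x, discreteGradient f star x ∂μ - ∫ x, discreteGradient f star x ∂ν‖ ≤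
      L * (transportDist μ ν).toReal := by
  have hc := continuous_discreteGradient hL
  have hne : Nonempty {γ : Measure ((∀ i, K i) × (∀ i, K i)) // γ.fst = μ ∧ γ.snd = ν} :=
    ⟨μ.prod ν, by simp, by simp⟩
  have key : ENNReal.ofReal
      ‖∫ x, discreteGradient f star x ∂μ - ∫ x, discreteGradient f star x ∂ν‖ ≤
      L * transportDist μ ν := by
    rw [transportDist, ENNReal.mul_iInf (by simp)]
    refine le_iInf fun γ => ?_
    obtain ⟨γ, rfl, rfl⟩ := γ
    have hγ : IsProbabilityMeasure γ := ⟨by rw [← Measure.fst_univ, measure_univ]⟩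
    have hi := integrable_of_abs_le (μ := γ) continuous_avgDist.measurable (M := 1) fun p => by
      rw [abs_of_nonneg (avgDist_nonneg _ _)]; exact avgDist_le_one hdiam _ _
    have hsm := hc.stronglyMeasurable
    have e1 : ∫ x, discreteGradient f star x ∂γ.fst = ∫ p, discreteGradient f star p.1 ∂γ :=
      integral_map measurable_fst.aemeasurable hsm.aestronglyMeasurable
    have e2 : ∫ x, discreteGradient f star x ∂γ.snd = ∫ p, discreteGradient f star p.2 ∂γ :=
      integral_map measurable_snd.aemeasurable hsm.aestronglyMeasurable
    rw [e1, e2]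
    have i1 : Integrable (fun p : (∀ i, K i) × (∀ i, K i) => discreteGradient f star p.1) γ :=
      (integrable_discreteGradient hc γ.fst).comp_measurable measurable_fst
    have i2 : Integrable (fun p : (∀ i, K i) × (∀ i, K i) => discreteGradient f star p.2) γ :=
      (integrable_discreteGradient hc γ.snd).comp_measurable measurable_snd
    rw [← integral_sub i1 i2, ← ofReal_integral_eq_lintegral_ofReal hi
      (ae_of_all _ fun p => avgDist_nonneg _ _), ← ENNReal.ofReal_coe_nnreal,
      ← ENNReal.ofReal_mul (NNReal.coe_nonneg L), ← integral_const_mul]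
    exact ENNReal.ofReal_le_ofReal (norm_integral_le_of_norm_le (hi.const_mul _)
      (ae_of_all _ fun p => hL _ _))
  have := ENNReal.toReal_mono (ENNReal.mul_ne_top ENNReal.coe_ne_top hfin) key
  rwa [ENNReal.toReal_ofReal (norm_nonneg _), ENNReal.toReal_mul, ENNReal.coe_toReal] at this

/-- Marton's transportation inequality for product measures, linearized in the parameter `s`. -/
theorem transportDist_withDensity_pi_le (hn : 0 < n)
    (hdiam : ∀ (i : Fin n) (a b : K i), dist a b ≤ 1) (ξ : ∀ i, Measure (K i))
    [∀ i, IsProbabilityMeasure (ξ i)] {H : (∀ i, K i) → ℝ} (hH : Measurable H)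
    (h0 : ∀ x, 0 ≤ H x) {M : ℝ} (hM : ∀ x, H x ≤ M) (h1 : ∫ x, H x ∂Measure.pi ξ = 1)
    {s : ℝ} (hs : 0 < s) :
    transportDist ((Measure.pi ξ).withDensity fun x => ENNReal.ofReal (H x)) (Measure.pi ξ) ≤
      ENNReal.ofReal (s / (2 * n) * ∫ x, H x * Real.log (H x) ∂Measure.pi ξ + 1 / (4 * s)) := by
  obtain ⟨γ, hγ1, hγ2, hγ3⟩ := exists_coupling_of_dependsOn (ξ := ξ)
    (c := fun i a b => ENNReal.ofReal (dist a b))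
    (fun i => (continuous_dist.measurable).ennreal_ofReal)
    (fun i a b => by simpa using hdiam i a b) (fun i a => by simp) hs Finset.univ hH h0 hM h1
    fun x y h => by rw [funext fun i => h i (by simp)]
  refine (iInf_le _ ⟨γ, hγ1, hγ2⟩).trans ?_
  have e : ∀ p : (∀ i, K i) × (∀ i, K i), ENNReal.ofReal (avgDist p.1 p.2) =
      ENNReal.ofReal (1 / n) * ∑ i, ENNReal.ofReal (dist (p.1 i) (p.2 i)) := fun p => by
    rw [avgDist, ENNReal.ofReal_mul (by positivity),
      ENNReal.ofReal_sum_of_nonneg fun _ _ => dist_nonneg]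
  simp_rw [e]
  rw [lintegral_const_mul' _ _ ENNReal.ofReal_ne_top]
  refine (mul_le_mul_right hγ3 _).trans ?_
  rw [← ENNReal.ofReal_mul (by positivity)]
  refine ENNReal.ofReal_le_ofReal (le_of_eq ?_)
  have : (n : ℝ) ≠ 0 := by positivity
  rw [Finset.card_univ, Fintype.card_fin]
  field_simp

theorem posBdd_exp (g : (∀ i, K i) →ᵇ ℝ) : PosBdd fun x => Real.exp (g x) :=
  .exp_of_abs_le g.continuous.measurable (abs_apply_le g)

instance isProbabilityMeasure_gibbs (g : (∀ i, K i) →ᵇ ℝ) : IsProbabilityMeasure (gibbs lam g) :=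
  isProbabilityMeasure_tilted ((posBdd_exp g).integrable _)

/-- Marton's inequality with reference `ξ_{∇f(z,·)}`, a product measure, and the explicit entropy of
the conditioned law. Finiteness is recorded so that `toReal` loses nothing. -/
theorem transportDist_cond_gibbs_le (hn : 0 < n)
    (hdiam : ∀ (i : Fin n) (a b : K i), dist a b ≤ 1) (f : (∀ i, K i) →ᵇ ℝ) (star z : ∀ i, K i)
    {P : Set (∀ i, K i)} (hP : MeasurableSet P) (hPpos : gibbs lam f P ≠ 0) {s : ℝ} (hs : 0 < s) :
    transportDist (gibbs lam f)[|P] (gibbs lam (discreteGradient f star z)) ≠ ∞ ∧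
    (transportDist (gibbs lam f)[|P] (gibbs lam (discreteGradient f star z))).toReal ≤
      s / (2 * n) * (∫ x, f x ∂(gibbs lam f)[|P] -
        ∫ x, discreteGradient f star z x ∂(gibbs lam f)[|P] +
        logPartition lam (discreteGradient f star z) - logPartition lam f -
        Real.log ((gibbs lam f).real P)) + 1 / (4 * s) := by
  obtain ⟨H, M, mH, h0, hM, h1, hd, hent⟩ := exists_density_cond_tilted
    (lam := Measure.pi lam) f.continuous.measurable
    (discreteGradient f star z).continuous.measurable (abs_apply_le f)
    (abs_apply_le (discreteGradient f star z)) hP hPpos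
  have hpr : ∀ i, IsProbabilityMeasure ((lam i).tilted (partialDiff f star i z)) := fun i => by
    have hm : Measurable (partialDiff f star i z) := by
      have : Continuous (partialDiff f star i z) := by
        unfold partialDiff
        exact (f.continuous.comp (continuous_const.update i continuous_id)).sub continuous_const
      exact this.measurable
    exact isProbabilityMeasure_tilted ((PosBdd.exp_of_abs_le hm (M := ‖f‖ + ‖f‖) fun t =>
      (abs_sub _ _).trans (add_le_add (abs_apply_le f _) (abs_apply_le f _))).integrable _)
  have hpos := integral_mul_log_nonneg (μ := gibbs lam (discreteGradient f star z)) mH h0 hM h1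
  have hpi := gibbs_discreteGradient lam f star z
  have hb : transportDist (gibbs lam f)[|P] (gibbs lam (discreteGradient f star z)) ≤ _ :=
    (congrArg₂ transportDist (hd.trans (congrArg (fun ν => Measure.withDensity ν _) hpi))
      hpi).trans_le (transportDist_withDensity_pi_le hn hdiam _ mH h0 hM
        (by rw [← hpi]; exact h1) hs)
  rw [← hpi] at hb
  refine ⟨ne_top_of_le_ne_top ENNReal.ofReal_ne_top hb,
    (ENNReal.toReal_le_of_le_ofReal (by positivity) hb).trans (le_of_eq ?_)⟩
  rw [gibbs, hent]
  rfl

end Gibbs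

/-! ### Averaging over the partition and conclusion -/

section Main

theorem sum_setIntegral_eq {α : Type*} [MeasurableSpace α] {μ : Measure α}
    {parts : Finset (Set α)} (hpart : Setoid.IsPartition (parts : Set (Set α)))
    (hmeas : ∀ P ∈ parts, MeasurableSet P) {φ : α → ℝ} (hφ : Integrable φ μ) :
    ∑ P ∈ parts, ∫ x in P, φ x ∂μ = ∫ x, φ x ∂μ := by
  have h := integral_biUnion_finset (μ := μ) (f := φ) parts (s := id) hmeas
    hpart.pairwiseDisjoint fun P _ => hφ.integrableOn
  have hU : ⋃ P ∈ parts, id P = Set.univ := by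
    rw [← hpart.sUnion_eq_univ, Set.sUnion_eq_biUnion]
    rfl
  rw [hU, setIntegral_univ] at h
  exact h.symm

theorem partitionEntropy_nonneg {α : Type*} [MeasurableSpace α] (μ : Measure α)
    [IsProbabilityMeasure μ] (parts : Finset (Set α)) : 0 ≤ partitionEntropy μ parts :=
  Finset.sum_nonneg fun _ _ => Real.negMulLog_nonneg measureReal_nonneg measureReal_le_one

theorem exists_half_mul_add_eq_sqrt {D : ℝ} (hD : 0 < D) :
    ∃ s : ℝ, 0 < s ∧ s / 2 * D + 1 / (4 * s) = √(1 / 2 * D) := by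
  have hr : 0 < √(1 / 2 * D) := Real.sqrt_pos.2 (by positivity)
  -- This is the minimizer `s = 1 / √(2 D)`, at which the two summands are equal.
  refine ⟨1 / (2 * √(1 / 2 * D)), by positivity, ?_⟩
  have hsq := Real.sq_sqrt (by positivity : 0 ≤ 1 / 2 * D)
  set r := √(1 / 2 * D)
  have : D = 2 * r ^ 2 := by linarith
  rw [this]
  field_simp
  ring

theorem discreteGradient_self {n : ℕ} {K : Fin n → Type*} [∀ i, MetricSpace (K i)]
    (f : (∀ i, K i) →ᵇ ℝ) (star x : ∀ i, K i) :
    discreteGradient f star x x = ∑ i, (f x - f (Function.update x i (star i))) := by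
  rw [discreteGradient_apply]
  refine Finset.sum_congr rfl fun i _ => ?_
  rw [partialDiff, Function.update_eq_self]

variable {n : ℕ} {K : Fin n → Type*} [∀ i, MetricSpace (K i)] [∀ i, MeasurableSpace (K i)]
  [∀ i, BorelSpace (K i)] [∀ i, SecondCountableTopology (K i)] (lam : ∀ i, Measure (K i))
  [∀ i, IsProbabilityMeasure (lam i)] (f : (∀ i, K i) →ᵇ ℝ) (star : ∀ i, K i)

/-- The normalizing integral of an additive potential factorizes, and the reference-point term of
each factor is constant in the integration variable. -/
theorem logPartition_discreteGradient (x : ∀ i, K i) :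
    logPartition lam (discreteGradient f star x) =
      ∑ i, (Real.log (coordAvg lam i (fun z => Real.exp (f z)) x) -
        f (Function.update x i (star i))) := by
  have h1 : ∫ z, Real.exp (discreteGradient f star x z) ∂Measure.pi lam =
      ∏ i, coordAvg lam i (fun z => Real.exp (f z)) x *
        Real.exp (-f (Function.update x i (star i))) := by
    simp_rw [discreteGradient_apply, Real.exp_sum]
    rw [integral_fintype_prod_eq_prod (fun i t => Real.exp (partialDiff f star i x t))]
    refine Finset.prod_congr rfl fun i _ => ?_
    rw [coordAvg, ← integral_mul_const]
    refine integral_congr_ae (ae_of_all _ fun t => ?_)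
    simp only
    rw [← Real.exp_add]
    rfl
  have hp : ∀ i, 0 < coordAvg lam i (fun z => Real.exp (f z)) x := fun i =>
    ((posBdd_exp f).coordAvg i).pos x
  rw [logPartition, h1, Real.log_prod fun i _ => (mul_pos (hp i) (Real.exp_pos _)).ne']
  refine Finset.sum_congr rfl fun i _ => ?_
  rw [Real.log_mul (hp i).ne' (Real.exp_pos _).ne', Real.log_exp, sub_eq_add_neg]

theorem integrable_update_star (i : Fin n) (μ : Measure (∀ i, K i)) [IsFiniteMeasure μ] :
    Integrable (fun x => f (Function.update x i (star i))) μ :=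
  integrable_of_abs_le
    (f.continuous.comp (continuous_id.update i continuous_const)).measurable
    fun _ => abs_apply_le f _

theorem integrable_boundedContinuous (μ : Measure (∀ i, K i)) [IsFiniteMeasure μ]
    (g : (∀ i, K i) →ᵇ ℝ) : Integrable g μ :=
  integrable_of_abs_le g.continuous.measurable (abs_apply_le g)

theorem integrable_discreteGradient_self (μ : Measure (∀ i, K i)) [IsFiniteMeasure μ] :
    Integrable (fun x => discreteGradient f star x x) μ := by
  simp_rw [discreteGradient_self]
  exact integrable_finsetSum _ fun i _ =>
    (integrable_boundedContinuous μ f).sub (integrable_update_star f star i μ)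

theorem integrable_log_coordAvg_exp (i : Fin n) (μ : Measure (∀ i, K i)) [IsFiniteMeasure μ] :
    Integrable (fun x => Real.log (coordAvg lam i (fun z => Real.exp (f z)) x)) μ := by
  have hp := (posBdd_exp f).coordAvg (ξ := lam) i
  obtain ⟨M, hM⟩ := hp.exists_abs_log_le
  exact integrable_of_abs_le (Real.measurable_log.comp hp.1) hM

theorem integrable_logPartition_discreteGradient (μ : Measure (∀ i, K i)) [IsFiniteMeasure μ] :
    Integrable (fun x => logPartition lam (discreteGradient f star x)) μ := by
  simp_rw [logPartition_discreteGradient]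
  exact integrable_finsetSum _ fun i _ =>
    (integrable_log_coordAvg_exp lam f i μ).sub (integrable_update_star f star i μ)

/-- The relative entropy of the Gibbs measure is at most the average of the relative entropies of
its product approximations; this is tensorization of entropy. -/
theorem integral_sub_logPartition_le :
    ∫ x, f x ∂gibbs lam f - logPartition lam f ≤
      ∫ x, discreteGradient f star x x ∂gibbs lam f -
        ∫ x, logPartition lam (discreteGradient f star x) ∂gibbs lam f := by
  have pF := posBdd_exp f
  have hZ := pF.integral_pos (Measure.pi lam)
  have hμ : ∀ φ : (∀ i, K i) → ℝ, ∫ x, φ x ∂gibbs lam f =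
      (∫ x, Real.exp (f x) * φ x ∂Measure.pi lam) /
        ∫ x, Real.exp (f x) ∂Measure.pi lam := fun φ => by
    rw [gibbs, integral_tilted, ← integral_div]
    refine integral_congr_ae (ae_of_all _ fun x => ?_)
    simp only [smul_eq_mul]
    ring
  have hi := fun i => integrable_log_coordAvg_exp lam f i (gibbs lam f)
  have hi' : ∀ i, Integrable (fun x => f x -
      Real.log (coordAvg lam i (fun z => Real.exp (f z)) x)) (gibbs lam f) := fun i =>
    (integrable_boundedContinuous _ f).sub (hi i)
  -- The reference-point terms cancel, leaving the logarithms of `e^f / E_i e^f` that occur in the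
  -- tensorization.
  have e1 : ∫ x, discreteGradient f star x x ∂gibbs lam f -
        ∫ x, logPartition lam (discreteGradient f star x) ∂gibbs lam f =
      ∑ i, ∫ x, (f x - Real.log (coordAvg lam i (fun z => Real.exp (f z)) x)) ∂gibbs lam f := by
    rw [← integral_sub (integrable_discreteGradient_self f star _)
      (integrable_logPartition_discreteGradient lam f star _),
      ← integral_finsetSum _ fun i _ => hi' i]
    refine integral_congr_ae (ae_of_all _ fun x => ?_)
    simp only
    rw [discreteGradient_self, logPartition_discreteGradient, ← Finset.sum_sub_distrib]
    refine Finset.sum_congr rfl fun i _ => ?_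
    ring
  have e2 : ∫ x, f x ∂gibbs lam f - logPartition lam f =
      ∫ x, (f x - logPartition lam f) ∂gibbs lam f := by
    rw [integral_sub (integrable_boundedContinuous _ f) (integrable_const _)]
    simp
  rw [e1, e2, hμ]
  simp_rw [hμ]
  rw [← Finset.sum_div]
  refine div_le_div_of_nonneg_right ?_ hZ.le
  have ht := integral_mul_log_div_integral_le_sum (ξ := lam) pF
  have l1 : ∀ x, Real.log (Real.exp (f x) / ∫ z, Real.exp (f z) ∂Measure.pi lam) =
      f x - logPartition lam f := fun x => by
    rw [Real.log_div (Real.exp_pos _).ne' hZ.ne', Real.log_exp, logPartition]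
  have l2 : ∀ i x, Real.log (Real.exp (f x) / coordAvg lam i (fun z => Real.exp (f z)) x) =
      f x - Real.log (coordAvg lam i (fun z => Real.exp (f z)) x) := fun i x => by
    rw [Real.log_div (Real.exp_pos _).ne' ((pF.coordAvg i).pos x).ne', Real.log_exp]
  simpa only [l1, l2] using ht

/-- The transportation distance to the best product approximation on a part `P`, weighted by the
mass of `P`. -/
theorem measureReal_mul_transportDist_le (hn : 0 < n)
    (hdiam : ∀ (i : Fin n) (a b : K i), dist a b ≤ 1) {δ : ℝ} {P : Set (∀ i, K i)}
    (hP : MeasurableSet P)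
    (hsmall : ∀ x ∈ P, ∀ y ∈ P,
      ‖discreteGradient f star x - discreteGradient f star y‖ < δ * n)
    (hPpos : gibbs lam f P ≠ 0) {y : ∀ i, K i}
    (hmin : IsMinOn (fun z : ∀ i, K i => transportDist (gibbs lam f)[|P]
        (gibbs lam (discreteGradient f star z))) P y) {s : ℝ} (hs : 0 < s) :
    (gibbs lam f).real P *
        (transportDist (gibbs lam f)[|P] (gibbs lam (discreteGradient f star y))).toReal ≤
      s / (2 * n) * (∫ x in P, f x ∂gibbs lam f + (gibbs lam f).real P * (δ * n) -
        ∫ x in P, discreteGradient f star x x ∂gibbs lam f +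
        ∫ x in P, logPartition lam (discreteGradient f star x) ∂gibbs lam f -
        (gibbs lam f).real P * logPartition lam f + Real.negMulLog ((gibbs lam f).real P)) +
        (gibbs lam f).real P * (1 / (4 * s)) := by
  set μ := gibbs lam f
  set q := μ.real P with hq
  have hq0 : 0 < q := ENNReal.toReal_pos hPpos (measure_ne_top _ _)
  have hprob : IsProbabilityMeasure μ[|P] := cond_isProbabilityMeasure hPpos
  have hcond : ∀ φ : (∀ i, K i) → ℝ, q * ∫ x, φ x ∂μ[|P] = ∫ x in P, φ x ∂μ := fun φ => by
    rw [ProbabilityTheory.cond, integral_smul_measure, smul_eq_mul, ENNReal.toReal_inv,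
      ← measureReal_def, mul_inv_cancel_left₀ hq0.ne']
  set d := (transportDist μ[|P] (gibbs lam (discreteGradient f star y))).toReal
  set D := fun x : ∀ i, K i => discreteGradient f star x x
  set ℓ := fun x : ∀ i, K i => logPartition lam (discreteGradient f star x)
  have hz : ∀ z ∈ P, d ≤ s / (2 * n) * (∫ x, f x ∂μ[|P] + δ * n - ∫ x, D x ∂μ[|P] + ℓ z -
      logPartition lam f - Real.log q) + 1 / (4 * s) := by
    intro z hzP
    obtain ⟨hfin, hle⟩ := transportDist_cond_gibbs_le lam hn hdiam f star z hP hPpos hs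
    -- Minimality of `y` allows an arbitrary `z ∈ P` on the right-hand side.
    have h1 : d ≤ _ := (ENNReal.toReal_mono hfin (hmin hzP)).trans hle
    -- Evaluating `∇f(x, ·) - ∇f(z, ·)` at `x` itself trades `∇f(z, x)` for the diagonal `∇f(x, x)`
    -- at cost `δ n`.
    have h2 : ∫ x, D x ∂μ[|P] - δ * n ≤ ∫ x, discreteGradient f star z x ∂μ[|P] := by
      have : ∫ x, (D x - δ * n) ∂μ[|P] = ∫ x, D x ∂μ[|P] - δ * n := by
        rw [integral_sub (integrable_discreteGradient_self f star _) (integrable_const _)]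
        simp [D]
      rw [← this]
      refine integral_mono_ae ((integrable_discreteGradient_self f star _).sub
        (integrable_const _)) (integrable_boundedContinuous _ _) ?_
      filter_upwards [ae_cond_mem hP] with x hx
      have h3 := (abs_apply_le (discreteGradient f star x - discreteGradient f star z) x).trans
        (hsmall x hx z hzP).le
      rw [BoundedContinuousFunction.sub_apply] at h3
      have := (abs_le.1 h3).2
      simp only [D]
      linarith
    refine h1.trans (add_le_add_left (mul_le_mul_of_nonneg_left ?_ (by positivity)) _)
    simp only [ℓ]
    linarith
  have hℓ := integrable_logPartition_discreteGradient lam f star μ[|P]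
  have hint : d ≤ s / (2 * n) * (∫ x, f x ∂μ[|P] + δ * n - ∫ x, D x ∂μ[|P] + ∫ x, ℓ x ∂μ[|P] -
      logPartition lam f - Real.log q) + 1 / (4 * s) := by
    set a := ∫ x, f x ∂μ[|P] + δ * n - ∫ x, D x ∂μ[|P]
    have hg : Integrable (fun z => s / (2 * n) * ℓ z + (s / (2 * n) *
        (a - logPartition lam f - Real.log q) + 1 / (4 * s))) μ[|P] :=
      (hℓ.const_mul _).add (integrable_const _)
    -- Averages the bound over `z` drawn from `μ[|P]`; only the log-partition term depends on `z`.
    have h1 := integral_mono_ae (integrable_const d) hg (by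
      filter_upwards [ae_cond_mem hP] with z hzP
      have := hz z hzP
      linarith)
    rw [integral_add (hℓ.const_mul _) (integrable_const _), integral_const_mul] at h1
    simp only [integral_const, probReal_univ, one_smul] at h1
    linarith
  have := mul_le_mul_of_nonneg_left hint hq0.le
  refine this.trans (le_of_eq ?_)
  rw [← hcond, ← hcond, ← hcond, Real.negMulLog]
  ring

/-- Triangle inequality through the mean of `∇f` under `μ[|P]`. Since `s` is common to all parts,
the integrals over parts add up to integrals over the whole space, where
`integral_sub_logPartition_le` discards everything but the partition entropy and `δ n`. -/
theorem sum_measureReal_mul_norm_le (hn : 0 < n)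
    (hdiam : ∀ (i : Fin n) (a b : K i), dist a b ≤ 1) {L : ℝ≥0}
    (hL : ∀ x y : ∀ i, K i,
      ‖discreteGradient f star x - discreteGradient f star y‖ ≤ (L : ℝ) * avgDist x y)
    {δ : ℝ} {parts : Finset (Set (∀ i, K i))}
    (hpart : Setoid.IsPartition (parts : Set (Set (∀ i, K i))))
    (hmeas : ∀ P ∈ parts, MeasurableSet P)
    (hsmall : ∀ P ∈ parts, ∀ x ∈ P, ∀ y ∈ P,
      ‖discreteGradient f star x - discreteGradient f star y‖ < δ * n)
    {y : Set (∀ i, K i) → ∀ i, K i} (hy : ∀ P ∈ parts, y P ∈ P)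
    (hmin : ∀ P ∈ parts, gibbs lam f P ≠ 0 →
      IsMinOn (fun z : ∀ i, K i => transportDist (gibbs lam f)[|P]
        (gibbs lam (discreteGradient f star z))) P (y P)) {s : ℝ} (hs : 0 < s) :
    ∑ P ∈ parts, (gibbs lam f).real P * ‖discreteGradient f star (y P) -
          ∫ x, discreteGradient f star x ∂gibbs lam (discreteGradient f star (y P))‖ ≤
      δ * n + L * (s / 2 * (partitionEntropy (gibbs lam f) parts / n + δ) + 1 / (4 * s)) := by
  set μ := gibbs lam f
  have hc := continuous_discreteGradient hL
  have hterm : ∀ P ∈ parts, μ.real P * ‖discreteGradient f star (y P) -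
          ∫ x, discreteGradient f star x ∂gibbs lam (discreteGradient f star (y P))‖ ≤
      μ.real P * (δ * n) + L * (s / (2 * n) * (∫ x in P, f x ∂μ + μ.real P * (δ * n) -
        ∫ x in P, discreteGradient f star x x ∂μ +
        ∫ x in P, logPartition lam (discreteGradient f star x) ∂μ -
        μ.real P * logPartition lam f + Real.negMulLog (μ.real P)) +
        μ.real P * (1 / (4 * s))) := by
    intro P hP
    -- On a null part every term vanishes, so no minimality is needed there.
    by_cases h0 : μ P = 0
    · simp [measureReal_def, h0, Measure.restrict_eq_zero.2 h0]
    have hprob : IsProbabilityMeasure μ[|P] := cond_isProbabilityMeasure h0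
    have hfin := (transportDist_cond_gibbs_le lam hn hdiam f star (y P) (hmeas P hP) h0 hs).1
    have hd := measureReal_mul_transportDist_le lam f star hn hdiam (hmeas P hP) (hsmall P hP) h0
      (hmin P hP h0) hs
    have h1 : ‖discreteGradient f star (y P) - ∫ x, discreteGradient f star x ∂μ[|P]‖ ≤
        δ * n := by
      have : discreteGradient f star (y P) - ∫ x, discreteGradient f star x ∂μ[|P] =
          ∫ x, (discreteGradient f star (y P) - discreteGradient f star x) ∂μ[|P] := by
        rw [integral_sub (integrable_const _) (integrable_discreteGradient hc _)]
        simp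
      rw [this]
      have := norm_integral_le_of_norm_le_const (μ := μ[|P]) (C := δ * n)
        (f := fun x => discreteGradient f star (y P) - discreteGradient f star x) (by
          filter_upwards [ae_cond_mem (hmeas P hP)] with x hx
          exact (hsmall P hP _ (hy P hP) _ hx).le)
      simpa using this
    have h2 := norm_integral_sub_integral_le hdiam hL μ[|P]
      (gibbs lam (discreteGradient f star (y P))) hfin
    have h3 := norm_sub_le_norm_sub_add_norm_sub (discreteGradient f star (y P))
      (∫ x, discreteGradient f star x ∂μ[|P])
      (∫ x, discreteGradient f star x ∂gibbs lam (discreteGradient f star (y P)))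
    have h4 := mul_le_mul_of_nonneg_left (h3.trans (add_le_add h1 h2))
      (measureReal_nonneg (μ := μ) (s := P))
    have h5 := mul_le_mul_of_nonneg_left hd (NNReal.coe_nonneg L)
    refine h4.trans ?_
    rw [mul_add, mul_left_comm (μ.real P) (L : ℝ)]
    exact add_le_add_right h5 _
  have hone : ∑ P ∈ parts, μ.real P = 1 := by
    have := sum_setIntegral_eq (μ := μ) hpart hmeas (integrable_const (1 : ℝ))
    simpa using this
  refine (Finset.sum_le_sum hterm).trans ?_
  simp only [Finset.sum_add_distrib, Finset.sum_sub_distrib, ← Finset.sum_mul, ← Finset.mul_sum,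
    hone]
  rw [sum_setIntegral_eq hpart hmeas (integrable_boundedContinuous μ f),
    sum_setIntegral_eq hpart hmeas (integrable_discreteGradient_self f star μ),
    sum_setIntegral_eq hpart hmeas (integrable_logPartition_discreteGradient lam f star μ)]
  have ht := integral_sub_logPartition_le lam f star
  have hent : ∑ P ∈ parts, Real.negMulLog (μ.real P) = partitionEntropy μ parts := rfl
  rw [hent, one_mul, one_mul, one_mul]
  refine add_le_add_right (mul_le_mul_of_nonneg_left (add_le_add_left ?_ _) L.2) _
  have hn' : (0 : ℝ) < n := by exact_mod_cast hn
  have : s / 2 * (partitionEntropy μ parts / n + δ) =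
      s / (2 * n) * (partitionEntropy μ parts + δ * n) := by field_simp
  rw [this]
  refine mul_le_mul_of_nonneg_left ?_ (by positivity)
  linarith

end Main

end GibbsMixture

theorem proposition4p1 {n : ℕ} {K : Fin n → Type*} [∀ i, MetricSpace (K i)]
    [∀ i, CompleteSpace (K i)] [∀ i, TopologicalSpace.SeparableSpace (K i)]
    [∀ i, MeasurableSpace (K i)] [∀ i, BorelSpace (K i)]
    (hdiam : ∀ (i : Fin n) (a b : K i), dist a b ≤ 1)
    (lam : ∀ i, Measure (K i)) [∀ i, IsProbabilityMeasure (lam i)]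
    (star : ∀ i, K i) (f : (∀ i, K i) →ᵇ ℝ)
    -- `∇f` is `L`-Lipschitz from `d_n` to the uniform norm
    (L : ℝ≥0)
    (hL : ∀ x y : ∀ i, K i,
      ‖GibbsMixture.discreteGradient f star x - GibbsMixture.discreteGradient f star y‖
        ≤ (L : ℝ) * GibbsMixture.avgDist x y)
    -- a finite measurable partition on whose parts `∇f` varies by less than `δ n`
    (δ : ℝ) (parts : Finset (Set (∀ i, K i)))
    (hpart : Setoid.IsPartition (parts : Set (Set (∀ i, K i))))
    (hmeas : ∀ P ∈ parts, MeasurableSet P)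
    (hsmall : ∀ P ∈ parts, ∀ x ∈ P, ∀ y ∈ P,
      ‖GibbsMixture.discreteGradient f star x - GibbsMixture.discreteGradient f star y‖
        < δ * n)
    -- points `y P ∈ P` that minimize the transportation distance
    (y : Set (∀ i, K i) → ∀ i, K i) (hy : ∀ P ∈ parts, y P ∈ P)
    (hmin : ∀ P ∈ parts, GibbsMixture.gibbs lam f P ≠ 0 →
      IsMinOn (fun z : ∀ i, K i => GibbsMixture.transportDist ((GibbsMixture.gibbs lam f)[|P])
        (GibbsMixture.gibbs lam (GibbsMixture.discreteGradient f star z))) P (y P)) :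
    (∀ P ∈ parts, Integrable (fun x : ∀ i, K i => GibbsMixture.discreteGradient f star x)
      (GibbsMixture.gibbs lam (GibbsMixture.discreteGradient f star (y P)))) ∧
    ∑ P ∈ parts, (GibbsMixture.gibbs lam f).real P *
        ‖GibbsMixture.discreteGradient f star (y P) -
          ∫ x, GibbsMixture.discreteGradient f star x
            ∂(GibbsMixture.gibbs lam (GibbsMixture.discreteGradient f star (y P)))‖
      ≤ δ * n + L * √((1 / 2) *
          (GibbsMixture.partitionEntropy (GibbsMixture.gibbs lam f) parts / n + δ)) := by
  have hsc : ∀ i, SecondCountableTopology (K i) := fun i =>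
    UniformSpace.secondCountable_of_separable (K i)
  obtain ⟨P, ⟨hP, hPstar⟩, -⟩ := hpart.2 star
  -- The strict oscillation bound at a pair of equal points, in the part containing `star`, forces
  -- both `n` and `δ` to be positive.
  have hpos : 0 < δ * n := by simpa using hsmall P hP star hPstar star hPstar
  have hn : 0 < n := by
    rcases n.eq_zero_or_pos with rfl | h
    · simp at hpos
    · exact h
  have hδ : 0 < δ := pos_of_mul_pos_left hpos (Nat.cast_nonneg n)
  refine ⟨fun P _ => GibbsMixture.integrable_discreteGradient
    (GibbsMixture.continuous_discreteGradient hL) _, ?_⟩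
  obtain ⟨s, hs, hs'⟩ := GibbsMixture.exists_half_mul_add_eq_sqrt
    (add_pos_of_nonneg_of_pos (div_nonneg (GibbsMixture.partitionEntropy_nonneg
      (GibbsMixture.gibbs lam f) parts) (Nat.cast_nonneg n)) hδ)
  rw [← hs']
  exact GibbsMixture.sum_measureReal_mul_norm_le lam f star hn hdiam hL hpart hmeas hsmall hy
    hmin hs
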